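/- Let $p$ be an odd prime, $n\ge 4$ an even integer and $\xi_p=e^{2\pi\sqrt{-1}/p}$, and let $x\cdot y$ be the ordinary inner product on $\mathbb{F}_p^n$. For $f:\mathbb{F}_p^n\to\mathbb{F}_p$ put $\mathcal{W}_f(\alpha)=\sum_{x\in\mathbb{F}_p^n}\xi_p^{f(x)-\alpha\cdot x}$. The function $f$ is bent if $|\mathcal{W}_f(\alpha)|=p^{n/2}$ for all $\alpha$; then $\mathcal{W}_f(\alpha)=\pm p^{n/2}\xi_p^{f^*(\alpha)}$ for a unique function $f^*:\mathbb{F}_p^n\to\mathbb{F}_p$, the dual of $f$, and $B_+(f)$ (respectively $B_-(f)$) is the set of those $\alpha$ for which the sign is $+$ (respectively $-$). A bent function $f$ is weakly regular if there is $\lambda\in\{\pm1,\pm\sqrt{-1}\}$ with $\mathcal{W}_f(\alpha)=\lambda p^{n/2}\xi_p^{f^*(\alpha)}$ for all $\alpha$, and non-weakly regular otherwise. The class $\mathcal{DBF}$ consists of the bent functions $f$ whose dual $f^*$ is also bent, with $f(0)=0$, and for which there is a positive integer $h$ with $\gcd(h-1,p-1)=1$ and $f(ax)=a^hf(x)$ for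 all $a\in\mathbb{F}_p^*$, $x\in\mathbb{F}_p^n$. For $f\in\mathcal{DBF}$ and $j\in\mathbb{F}_p$ put $c_j(f)=\{x\in B_+(f^*):f(x)=j\}$ and $d_j(f)=\{x\in B_-(f^*):f(x)=j\}$. A subspace $V\subseteq\mathbb{F}_p^n$ is non-degenerate if $V\cap V^\perp=\{0\}$, where $S^\perp=\{x: x\cdot y=0\text{ for all }y\in S\}$. A partition $\{U_i\}_{i=0}^d$ of $\mathbb{F}_p^n$ into nonempty sets with $U_0=\{0\}$ induces a $d$-class symmetric association scheme if the relations $R_i=\{(\alpha,\beta):\alpha-\beta\in U_i\}$, $0\le i\le d$, form a symmetric association scheme on $\mathbb{F}_p^n$, that is, if every $R_i$ is symmetric and for all $u,v,w$ and all $(x,y)\in R_w$ the number $|\{z:(x,z)\in R_u,\ (z,y)\in R_v\}|$ depends only on $u,v,w$. Theorem. Let $f:\mathbb{F}_p^n\to\mathbb{F}_p$ be a non-weakly regular bent function belonging to $\mathcal{DBF}$ such that $B_-(f)$ and $B_-(f^*)$ are both non-degenerate $r$-dimensional subspaces of $\mathbb{F}_p^n$ over $\mathbb{F}_p$. (1)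 If $r=\frac n2+1$, then $\{0\},c_0(f),c_1(f),\dots,c_{p-1}(f),d_0(f)\setminus\{0\},d_1(f),\dots,d_{p-1}(f)$ is a partition of $\mathbb{F}_p^n$ and induces a $2p$-class symmetric association scheme. (2) If $\frac n2+1<r\le n-1$, then $\{0\},c_0(f),c_1(f),\dots,c_{p-1}(f),B_-(f)^\perp\setminus\{0\},d_0(f)\setminus B_-(f)^\perp,d_1(f),\dots,d_{p-1}(f)$ is a partition of $\mathbb{F}_p^n$ and induces a $(2p+1)$-class symmetric association scheme. -/

import Mathlib

open scoped Matrix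

noncomputable section

namespace BentScheme

section Bent

variable {p n : ℕ} [NeZero p]

/-- The Walsh transform `W_f(α) = ∑ₓ ξ ^ (f(x) - α·x)`, where `ξ = exp(2πi/p)`;
`ZMod.stdAddChar j` is `ξ ^ j`. -/
def walsh (f : (Fin n → ZMod p) → ZMod p) (α : Fin n → ZMod p) : ℂ :=
  ∑ x : Fin n → ZMod p, ZMod.stdAddChar (f x - α ⬝ᵥ x)

/-- `f` is bent: `|W_f(α)| = p ^ (n/2)` for every `α`. -/
def IsBent (f : (Fin n → ZMod p) → ZMod p) : Prop :=
  ∀ α, ‖walsh f α‖ = (p : ℝ) ^ ((n : ℝ) / 2)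

/-- `μ * p ^ (n/2)`, where `μ = 1` if `p ^ n ≡ 1 (mod 4)` and `μ = √-1` otherwise, that is, if
`p ^ n ≡ 3 (mod 4)` (for odd `p`). -/
def amplitude (p n : ℕ) : ℂ :=
  (if p ^ n % 4 = 1 then 1 else Complex.I) * (((p : ℝ) ^ ((n : ℝ) / 2) : ℝ) : ℂ)

open Classical in
/-- The dual `f*` of `f`: `f*(α)` is the element `j` with `W_f(α) = ± μ p ^ (n/2) ξ ^ j`
(it is unique for odd `p`; where there is none, which does not happen for bent `f` and odd
prime `p`, the value is `0`). -/
def dual (f : (Fin n → ZMod p) → ZMod p) (α : Fin n → ZMod p) : ZMod p :=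
  if h : ∃ j : ZMod p, walsh f α = amplitude p n * ZMod.stdAddChar j ∨
      walsh f α = -amplitude p n * ZMod.stdAddChar j
  then h.choose else 0

/-- `f` is weakly regular: `W_f(α) = c p ^ (n/2) ξ ^ f*(α)` for all `α`, with a constant
`c ∈ {1, -1, √-1, -√-1}`. -/
def IsWeaklyRegular (f : (Fin n → ZMod p) → ZMod p) : Prop :=
  ∃ c ∈ ({1, -1, Complex.I, -Complex.I} : Set ℂ), ∀ α,
    walsh f α = c * (((p : ℝ) ^ ((n : ℝ) / 2) : ℝ) : ℂ) * ZMod.stdAddChar (dual f α)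

/-- `f` is a non-weakly regular bent function. -/
def IsNonWeaklyRegularBent (f : (Fin n → ZMod p) → ZMod p) : Prop :=
  IsBent f ∧ ¬ IsWeaklyRegular f

/-- `B₊(f)`. -/
def bPlus (f : (Fin n → ZMod p) → ZMod p) : Set (Fin n → ZMod p) :=
  {α | walsh f α = amplitude p n * ZMod.stdAddChar (dual f α)}

/-- `B₋(f)`. -/
def bMinus (f : (Fin n → ZMod p) → ZMod p) : Set (Fin n → ZMod p) :=
  {α | walsh f α = -amplitude p n * ZMod.stdAddChar (dual f α)}

/-- `c_j(f) = {x ∈ B₊(f*) : f(x) = j}`. -/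
def cSet (f : (Fin n → ZMod p) → ZMod p) (j : ZMod p) : Set (Fin n → ZMod p) :=
  {x | x ∈ bPlus (dual f) ∧ f x = j}

/-- `d_j(f) = {x ∈ B₋(f*) : f(x) = j}`. -/
def dSet (f : (Fin n → ZMod p) → ZMod p) (j : ZMod p) : Set (Fin n → ZMod p) :=
  {x | x ∈ bMinus (dual f) ∧ f x = j}

/-- The class `𝒟ℬℱ`: dual-bent functions (`f` and `f*` are bent) with `f(0) = 0`
for which there is a positive integer `h` with `gcd(h - 1, p - 1) = 1` and `f(a x) = a ^ h f(x)` for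
all `a ≠ 0` and all `x`. -/
structure IsDBF (f : (Fin n → ZMod p) → ZMod p) : Prop where
  bent : IsBent f
  dual_bent : IsBent (dual f)
  map_zero : f 0 = 0
  homogeneous : ∃ h : ℕ, 0 < h ∧ Nat.gcd (h - 1) (p - 1) = 1 ∧
    ∀ (a : ZMod p) (x : Fin n → ZMod p), a ≠ 0 → f (a • x) = a ^ h * f x

/-- The orthogonal complement with respect to the ordinary inner product. -/
def perp (S : Set (Fin n → ZMod p)) : Set (Fin n → ZMod p) :=
  {x | ∀ y ∈ S, x ⬝ᵥ y = 0}

/-- The set `S` is an `r`-dimensional subspace, non-degenerate with respect to the ordinary inner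
product. -/
def IsNondegenerateSubspace [Fact p.Prime] (S : Set (Fin n → ZMod p)) (r : ℕ) : Prop :=
  ∃ V : Submodule (ZMod p) (Fin n → ZMod p), (V : Set (Fin n → ZMod p)) = S ∧
    Module.finrank (ZMod p) V = r ∧
    {x : Fin n → ZMod p | x ∈ V ∧ ∀ y ∈ V, x ⬝ᵥ y = 0} = {0}

/-- The family `{0}, c_0, …, c_{p-1}, d_0 \ {0}, d_1, …, d_{p-1}`. -/
def familyTwo (f : (Fin n → ZMod p) → ZMod p) (i : Fin (2 * p + 1)) : Set (Fin n → ZMod p) :=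
  if i.val = 0 then {0}
  else if i.val ≤ p then cSet f ((i.val - 1 : ℕ) : ZMod p)
  else if i.val = p + 1 then dSet f 0 \ {0}
  else dSet f ((i.val - (p + 1) : ℕ) : ZMod p)

/-- The family
`{0}, c_0, …, c_{p-1}, B₋(f)^⊥ \ {0}, d_0 \ B₋(f)^⊥, d_1, …, d_{p-1}`. -/
def familyThree (f : (Fin n → ZMod p) → ZMod p) (i : Fin (2 * p + 1 + 1)) :
    Set (Fin n → ZMod p) :=
  if i.val = 0 then {0}
  else if i.val ≤ p then cSet f ((i.val - 1 : ℕ) : ZMod p)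
  else if i.val = p + 1 then perp (bMinus f) \ {0}
  else if i.val = p + 2 then dSet f 0 \ perp (bMinus f)
  else dSet f ((i.val - (p + 2) : ℕ) : ZMod p)

end Bent

section Schemes

/-- The sets `U i` are nonempty, pairwise disjoint and cover the whole type. -/
structure IsIndexedPartition {ι X : Type*} (U : ι → Set X) : Prop where
  nonempty : ∀ i, (U i).Nonempty
  disjoint : ∀ i j, i ≠ j → Disjoint (U i) (U j)
  cover : ∀ x, ∃ i, x ∈ U i

/-- `(X, {R_0, …, R_d})` is a `d`-class association scheme. -/
structure IsAssociationScheme {X : Type*} [Finite X] [Nonempty X] (d : ℕ)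
    (R : Fin (d + 1) → Set (X × X)) : Prop where
  partition : IsIndexedPartition R
  diagonal : R 0 = {q | q.1 = q.2}
  transpose : ∀ j, ∃ j', {q : X × X | (q.2, q.1) ∈ R j} = R j'
  intersection : ∃ N : Fin (d + 1) → Fin (d + 1) → Fin (d + 1) → ℕ,
    ∀ u v w, ∀ x y : X, (x, y) ∈ R w →
      Set.ncard {z : X | (x, z) ∈ R u ∧ (z, y) ∈ R v} = N u v w

/-- `(X, {R_0, …, R_d})` is a `d`-class symmetric association scheme. -/
structure IsSymmetricAssociationScheme {X : Type*} [Finite X] [Nonempty X] (d : ℕ)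
    (R : Fin (d + 1) → Set (X × X)) : Prop where
  scheme : IsAssociationScheme d R
  symmetric : ∀ j, {q : X × X | (q.2, q.1) ∈ R j} = R j

/-- The family `U_0, …, U_d` of subsets of `G` is a partition of `G` with `U_0 = {0}`, and the
relations `R_i = {(α, β) : α - β ∈ U_i}` form a `d`-class symmetric association scheme. -/
def InducesSymmetricScheme {G : Type*} [AddGroup G] [Finite G] (d : ℕ)
    (U : Fin (d + 1) → Set G) : Prop :=
  IsIndexedPartition U ∧ U 0 = {0} ∧
    IsSymmetricAssociationScheme d fun i => {q : G × G | q.1 - q.2 ∈ U i}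

end Schemes

end BentScheme

end

/-!
Write `n = 2m`, `q = p ^ m`, `V = B₋(f)`, `W = B₋(f*)`, and let `x ∼ y` mean that `x` and `y` agree
in being zero, in lying in `W`, in lying in `V^⊥`, and in the value of `f` (`SameClass`). Both families
consist of the classes of this relation. The proof is Fourier analysis on `𝔽_p^n`: the Fourier
transform exchanges the functions constant on the classes of `f` with those constant on the classes of
`f*`. As the latter are closed under pointwise products, the former are closed under convolution
(`convolution_eq`), and the intersection numbers are values of convolutions of indicator functions.

Two arithmetic facts carry this. First, a Walsh coefficient of a bent function is `± q ξ ^ j`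
(`exists_eq_pow_mul_stdAddChar_of_norm`), by total ramification of `p` in `ℚ(ξ)` and Kronecker's
theorem. Comparing the inversion formula of `f` with the Walsh transform of `f*` modulo `2` then gives
`f**(-y) = f(y)` (`dual_dual_neg`), and splits the inversion formula: the exponential sum of `f*` over
`V` is `-q ξ ^ f(y)` for `y ∈ -W` and zero elsewhere (`sum_bMinus`), similarly over the complement of
`V`. Since `f` is even and homogeneous, so that `f** = f` and `f*` is homogeneous, the situation is
symmetric in `f` and `f*`; `IsDualOn` records one half of it.

Second, the only integral relations between `p`-th roots of unity are the multiples of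
`1 + ξ + ⋯ + ξ ^ (p - 1) = 0`. So the Galois action `ξ ↦ ξ ^ c` can be applied to the split formula,
which together with homogeneity evaluates the sums of `ξ ^ (c f(y) + α·y)` over `W` and its complement
in terms of the class of `α` with respect to `f*`. These sums and the indicator functions of `{0}` and
`V^⊥` account for all functions constant on the classes, because `V^⊥ ⊆ W` and `f = 0` on `V^⊥`.
The same relations give the sizes of the level sets of `f` on `W`: for `dim W = m + 1` the zeros of `f`
in `W` form exactly `V^⊥`, so that `d_0 \ {0} = V^⊥ \ {0}`, and for larger dimension there are more zeros,
so that `V^⊥ \ {0}` splits off as a class of its own.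
-/

namespace BentScheme

/-! ### Linear relations between `p`-th roots of unity -/

section

variable {p : ℕ} [Fact p.Prime]

theorem isPrimitiveRoot_stdAddChar_one : IsPrimitiveRoot (ZMod.stdAddChar (1 : ZMod p)) p := by
  have h := Complex.isPrimitiveRoot_exp p (NeZero.ne p)
  have h1 : ZMod.stdAddChar (1 : ZMod p) = Complex.exp (2 * Real.pi * Complex.I / p) := by
    simpa using ZMod.stdAddChar_coe (N := p) 1
  rwa [h1]

theorem stdAddChar_eq_pow (j : ZMod p) :
    ZMod.stdAddChar j = ZMod.stdAddChar (1 : ZMod p) ^ j.val := by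
  rw [← AddChar.map_nsmul_eq_pow]
  simp

theorem sum_stdAddChar_mul {c : ZMod p} (hc : c ≠ 0) :
    ∑ j : ZMod p, ZMod.stdAddChar (c * j) = 0 := by
  have := AddChar.sum_mulShift c (ZMod.isPrimitive_stdAddChar p)
  simpa [hc, mul_comm] using this

/-- The only integral linear relations between the `p`-th roots of unity are the multiples of
`1 + ξ + ⋯ + ξ ^ (p - 1) = 0`. -/
theorem eq_of_sum_mul_stdAddChar_eq_zero {A : ZMod p → ℤ}
    (h : ∑ j, (A j : ℂ) * ZMod.stdAddChar j = 0) (i j : ZMod p) : A i = A j := by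
  set ξ : ℂ := ZMod.stdAddChar (1 : ZMod p) with hξ
  have hprim : IsPrimitiveRoot ξ p := isPrimitiveRoot_stdAddChar_one
  have hp : p.Prime := Fact.out
  -- normalize the last coefficient to zero, so that the degree drops below that of `Φ_p`
  set B : ℕ → ℤ := fun k => A k - A ((p - 1 : ℕ) : ZMod p) with hB
  have hsum0 : ∑ j : ZMod p, ZMod.stdAddChar j = 0 := by
    simpa using sum_stdAddChar_mul (p := p) one_ne_zero
  have hcast : ∀ F : ZMod p → ℂ, ∑ j, F j = ∑ k ∈ Finset.range p, F (k : ZMod p) := by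
    intro F
    refine Finset.sum_bij' (fun j _ => j.val) (fun k _ => (k : ZMod p)) ?_ ?_ ?_ ?_ ?_
    · intro a _; simpa using ZMod.val_lt a
    · simp
    · simp
    · intro a ha; exact ZMod.val_cast_of_lt (by simpa using ha)
    · simp
  have hB0 : ∑ k ∈ Finset.range (p - 1), (B k : ℂ) * ξ ^ k = 0 := by
    have h1 : ∑ j : ZMod p, ((A j : ℂ) - A ((p - 1 : ℕ) : ZMod p)) * ZMod.stdAddChar j = 0 := by
      simp_rw [sub_mul]
      rw [Finset.sum_sub_distrib, h, ← Finset.mul_sum, hsum0]; simp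
    rw [hcast] at h1
    have hp1 : p = (p - 1) + 1 := by have := hp.pos; omega
    rw [show Finset.range p = Finset.range ((p - 1) + 1) by rw [← hp1],
      Finset.sum_range_succ] at h1
    rw [sub_self, zero_mul, add_zero] at h1
    rw [← h1]
    refine Finset.sum_congr rfl fun k hk => ?_
    have : k < p := by have := Finset.mem_range.1 hk; omega
    rw [stdAddChar_eq_pow, ZMod.val_cast_of_lt this, hB]
    push_cast; rfl
  set P : Polynomial ℤ := ∑ k ∈ Finset.range (p - 1), Polynomial.C (B k) * Polynomial.X ^ k
    with hP
  have hPdeg : P.degree < (Polynomial.cyclotomic p ℤ).degree := by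
    rw [Polynomial.degree_cyclotomic, Nat.totient_prime hp]
    refine lt_of_le_of_lt (Polynomial.degree_sum_le _ _) ?_
    rw [Finset.sup_lt_iff (by exact WithBot.bot_lt_coe _)]
    intro k hk
    refine lt_of_le_of_lt (Polynomial.degree_C_mul_X_pow_le _ _) ?_
    exact_mod_cast Finset.mem_range.1 hk
  have hroot : Polynomial.aeval ξ P = 0 := by
    rw [hP, map_sum, ← hB0]
    simp
  have hdvd : Polynomial.cyclotomic p ℤ ∣ P := by
    rw [Polynomial.cyclotomic_eq_minpoly hprim hp.pos]
    exact minpoly.isIntegrallyClosed_dvd (hprim.isIntegral hp.pos) hroot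
  have hP0 : P = 0 := Polynomial.eq_zero_of_dvd_of_degree_lt hdvd hPdeg
  have hBz : ∀ k < p, B k = 0 := by
    intro k hk
    rcases Nat.lt_or_ge k (p - 1) with hk' | hk'
    · have : P.coeff k = B k := by
        rw [hP, Polynomial.finsetSum_coeff]
        simp [Polynomial.coeff_X_pow, hk']
      rw [← this, hP0, Polynomial.coeff_zero]
    · have : k = p - 1 := by omega
      simp [hB, this]
  have key : ∀ i : ZMod p, A i = A ((p - 1 : ℕ) : ZMod p) := by
    intro i
    have := hBz i.val (ZMod.val_lt i)
    simp only [hB, ZMod.natCast_val, ZMod.cast_id', id_eq] at this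
    linarith
  rw [key i, key j]

/-- Counting form of a relation `∑ w x ξ ^ g x = k ξ ^ j`: away from `j` the weighted number of
`x` with `g x = i` does not depend on `i`, and at `j` it exceeds the common value by `k`. -/
theorem exists_fiber_sum_eq {X : Type*} [Fintype X] {w : X → ℤ} {g : X → ZMod p} {k : ℤ}
    {j : ZMod p}
    (h : ∑ x, (w x : ℂ) * ZMod.stdAddChar (g x) = k * ZMod.stdAddChar j) :
    ∃ N : ℤ, ∀ i, (∑ x, if g x = i then w x else 0) = N + if i = j then k else 0 := by
  set A : ZMod p → ℤ := fun i => (∑ x, if g x = i then w x else 0) - if i = j then k else 0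
    with hA
  have h0 : ∑ i, (A i : ℂ) * ZMod.stdAddChar i = 0 := by
    simp only [hA]
    push_cast
    simp_rw [sub_mul, Finset.sum_mul, ite_mul, zero_mul]
    rw [Finset.sum_sub_distrib, Finset.sum_comm]
    simp [h]
  exact ⟨A j, fun i => by rw [eq_of_sum_mul_stdAddChar_eq_zero h0 j i]; simp [hA]⟩

/-- The Galois action `ξ ↦ ξ ^ c` on a relation between `p`-th roots of unity. -/
theorem sum_mul_stdAddChar_mul {X : Type*} [Fintype X] {w : X → ℤ} {g : X → ZMod p} {k : ℤ}
    {j : ZMod p} {c : ZMod p} (hc : c ≠ 0)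
    (h : ∑ x, (w x : ℂ) * ZMod.stdAddChar (g x) = k * ZMod.stdAddChar j) :
    ∑ x, (w x : ℂ) * ZMod.stdAddChar (c * g x) = k * ZMod.stdAddChar (c * j) := by
  obtain ⟨N, hN⟩ := exists_fiber_sum_eq h
  have h1 : ∑ x, (w x : ℂ) * ZMod.stdAddChar (c * g x) =
      ∑ i, ((∑ x, if g x = i then w x else 0 : ℤ) : ℂ) * ZMod.stdAddChar (c * i) := by
    push_cast
    simp_rw [Finset.sum_mul, ite_mul, zero_mul]
    rw [Finset.sum_comm]
    simp
  rw [h1]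
  simp_rw [hN]
  push_cast
  simp_rw [add_mul, ite_mul, zero_mul]
  rw [Finset.sum_add_distrib, ← Finset.mul_sum, sum_stdAddChar_mul hc]
  simp

end

/-! ### Sums of roots of unity of prescribed absolute value -/

section

variable {p : ℕ} [Fact p.Prime]

open NumberField in
/-- A sum of `p`-th roots of unity of absolute value `p ^ m` is, up to sign, `p ^ m` times a `p`-th
root of unity. Since `p` is totally ramified in `ℚ(ξ)`, such a sum `w` is a power of `ξ - 1` up to a
unit, so one of `w / p ^ m` and `p ^ m / w` is integral; its conjugates have absolute value one, and
Kronecker's theorem makes it a root of unity. -/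
theorem exists_eq_pow_mul_stdAddChar_of_norm (hp2 : Odd p) {X : Type*} [Fintype X]
    (g : X → ZMod p) (m : ℕ) (h : ‖∑ x, ZMod.stdAddChar (g x)‖ = (p : ℝ) ^ m) :
    ∃ j : ZMod p, ∑ x, ZMod.stdAddChar (g x) = (p : ℂ) ^ m * ZMod.stdAddChar j ∨
      ∑ x, ZMod.stdAddChar (g x) = -(p : ℂ) ^ m * ZMod.stdAddChar j := by
  let K := CyclotomicField p ℚ
  have : IsCyclotomicExtension {p} ℚ K := CyclotomicField.isCyclotomicExtension p ℚ
  have hp : p.Prime := Fact.out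
  -- choose an embedding `ψ` of `K` and a root `ζ` of `K` lying over `ξ`
  obtain ⟨ψ⟩ : Nonempty (K →+* ℂ) := inferInstance
  have hζ0 : IsPrimitiveRoot (IsCyclotomicExtension.zeta p ℚ K) p :=
    IsCyclotomicExtension.zeta_spec p ℚ K
  obtain ⟨k, -, hk⟩ := (hζ0.map_of_injective ψ.injective).eq_pow_of_pow_eq_one
    (isPrimitiveRoot_stdAddChar_one (p := p)).pow_eq_one
  set ζ : K := IsCyclotomicExtension.zeta p ℚ K ^ k with hζdef
  have hψζ : ψ ζ = ZMod.stdAddChar (1 : ZMod p) := by rw [hζdef, map_pow, hk]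
  have hζ : IsPrimitiveRoot ζ p :=
    IsPrimitiveRoot.of_map_of_injective (f := ψ) (by rw [hψζ]; exact isPrimitiveRoot_stdAddChar_one)
      ψ.injective
  have hζ' : hζ.toInteger ^ p = 1 := hζ.toInteger_isPrimitiveRoot.pow_eq_one
  let E : AddChar (ZMod p) (𝓞 K) := AddChar.zmodChar p hζ'
  let ι : 𝓞 K →+* K := algebraMap (𝓞 K) K
  have hE : ∀ j, ψ (ι (E j)) = ZMod.stdAddChar j := by
    intro j
    rw [show E j = hζ.toInteger ^ j.val from AddChar.zmodChar_apply hζ' j, map_pow, map_pow,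
      stdAddChar_eq_pow, ← hψζ]
    rfl
  let w : 𝓞 K := ∑ x, E (g x)
  let w' : 𝓞 K := ∑ x, E (-g x)
  have hconj : ∀ φ : K →+* ℂ, φ (ι w') = (starRingEnd ℂ) (φ (ι w)) := by
    intro φ
    simp only [w, w', map_sum]
    refine Finset.sum_congr rfl fun x _ => ?_
    exact AddChar.map_neg_eq_conj
      (((φ.comp ι : 𝓞 K →+* ℂ) : 𝓞 K →* ℂ).compAddChar E) (g x)
  have hψw : ψ (ι w) = ∑ x, ZMod.stdAddChar (g x) := by simp only [w, map_sum, hE]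
  have hinj : Function.Injective (ψ.comp ι) :=
    ψ.injective.comp (FaithfulSMul.algebraMap_injective (𝓞 K) K)
  have hww : w * w' = (p : 𝓞 K) ^ (m * 2) := by
    apply hinj
    change ψ (ι (w * w')) = ψ (ι _)
    rw [map_mul, map_mul, hconj, Complex.mul_conj, hψw, Complex.normSq_eq_norm_sq, h]
    simp only [map_pow, map_natCast]
    push_cast
    rw [pow_mul]
  have hnorm : ∀ φ : K →+* ℂ, ‖φ (ι w)‖ = (p : ℝ) ^ m := by
    intro φ
    have h1 : (‖φ (ι w)‖ : ℝ) ^ 2 = ((p : ℝ) ^ m) ^ 2 := by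
      have h2 : φ (ι (w * w')) = ((p : ℂ) ^ m) ^ 2 := by rw [hww]; simp [pow_mul]
      rw [map_mul, map_mul, hconj, Complex.mul_conj, Complex.normSq_eq_norm_sq] at h2
      exact_mod_cast h2
    exact (pow_left_inj₀ (norm_nonneg _) (by positivity) two_ne_zero).1 h1
  have hass : Associated ((hζ.toInteger - 1) ^ (p - 1)) (p : 𝓞 K) :=
    IsCyclotomicExtension.Rat.associated_zeta_sub_one_pow_prime p hζ
  have hdvd : w ∣ (hζ.toInteger - 1) ^ ((p - 1) * (m * 2)) := by
    rw [pow_mul]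
    exact (Dvd.intro _ hww).trans (hass.pow_pow (n := m * 2)).symm.dvd
  obtain ⟨i, -, hi⟩ := (dvd_prime_pow hζ.zeta_sub_one_prime' _).1 hdvd
  have hq : Associated ((hζ.toInteger - 1) ^ ((p - 1) * m)) ((p : 𝓞 K) ^ m) := by
    rw [pow_mul]; exact hass.pow_pow
  have hp0 : (p : ℝ) ^ m ≠ 0 := pow_ne_zero _ (by exact_mod_cast hp.ne_zero)
  -- an integer all of whose conjugates have absolute value one is `± ζ ^ r`
  have hroot : ∀ v : 𝓞 K, (∀ φ : K →+* ℂ, ‖φ (ι v)‖ = 1) →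
      ∃ r : ℕ, ψ (ι v) = ZMod.stdAddChar (r : ZMod p) ∨
        ψ (ι v) = -ZMod.stdAddChar (r : ZMod p) := by
    intro v hv
    obtain ⟨t, ht, hvt⟩ := Embeddings.pow_eq_one_of_norm_eq_one K ℂ v.isIntegral_coe hv
    obtain ⟨r, -, hr⟩ := hζ.exists_pow_or_neg_mul_pow_of_isOfFinOrder hp2
      (isOfFinOrder_iff_pow_eq_one.2 ⟨t, ht, hvt⟩)
    have he : ψ (ζ ^ r) = ZMod.stdAddChar (r : ZMod p) := by
      rw [map_pow, hψζ, ← AddChar.map_nsmul_eq_pow]; simp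
    refine ⟨r, hr.imp (fun hr => ?_) (fun hr => ?_)⟩
    · rw [← he, ← hr]
    · rw [← he, ← map_neg, ← hr]
  rw [← hψw]
  rcases le_total i ((p - 1) * m) with hle | hle
  · obtain ⟨v, hv⟩ : w ∣ (p : 𝓞 K) ^ m :=
      hi.dvd.trans ((pow_dvd_pow _ hle).trans hq.dvd)
    have hv1 : ∀ φ : K →+* ℂ, ‖φ (ι v)‖ = 1 := by
      intro φ
      have h1 : φ (ι w) * φ (ι v) = (p : ℂ) ^ m := by
        rw [← map_mul, ← map_mul, ← hv]; simp
      have h2 := congrArg norm h1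
      rw [norm_mul, hnorm, norm_pow, Complex.norm_natCast] at h2
      exact (mul_eq_left₀ hp0).1 h2
    have h1 : ψ (ι w) * ψ (ι v) = (p : ℂ) ^ m := by
      rw [← map_mul, ← map_mul, ← hv]; simp
    obtain ⟨r, hr⟩ := hroot v hv1
    have hrr : ZMod.stdAddChar (r : ZMod p) * ZMod.stdAddChar (-(r : ZMod p)) = (1 : ℂ) := by
      rw [← AddChar.map_add_eq_mul]; simp
    refine ⟨-r, hr.imp (fun hr => ?_) (fun hr => ?_)⟩
    · rw [← h1, hr, mul_assoc, hrr, mul_one]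
    · rw [← h1, hr]; linear_combination (-ψ (ι w)) * hrr
  · obtain ⟨v, hv⟩ : (p : 𝓞 K) ^ m ∣ w :=
      hq.symm.dvd.trans ((pow_dvd_pow _ hle).trans hi.symm.dvd)
    have h0 : ∀ φ : K →+* ℂ, φ (ι w) = (p : ℂ) ^ m * φ (ι v) := by
      intro φ
      rw [hv]; simp
    have hv1 : ∀ φ : K →+* ℂ, ‖φ (ι v)‖ = 1 := by
      intro φ
      have h2 := congrArg norm (h0 φ)
      rw [norm_mul, hnorm, norm_pow, Complex.norm_natCast] at h2
      exact (mul_eq_left₀ hp0).1 h2.symm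
    obtain ⟨r, hr⟩ := hroot v hv1
    refine ⟨r, hr.imp (fun hr => ?_) (fun hr => ?_)⟩
    · rw [h0, hr]
    · rw [h0, hr]; ring

end

/-! ### Walsh transforms of bent functions and their duals -/

section

variable {p n : ℕ}

theorem amplitude_eq_pow (hp : Odd p) (hn : Even n) : amplitude p n = (p : ℂ) ^ (n / 2) := by
  obtain ⟨m, rfl⟩ := hn
  have h1 : p ^ (m + m) % 4 = 1 := by
    have h2 : (p ^ m) % 2 = 1 := Nat.odd_iff.1 hp.pow
    have h3 : p ^ m % 4 = 1 ∨ p ^ m % 4 = 3 := by omega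
    rw [pow_add, Nat.mul_mod]
    rcases h3 with h | h <;> rw [h]
  have h4 : (m + m) / 2 = m := by omega
  have h5 : (((m + m : ℕ) : ℝ) / 2) = (m : ℝ) := by push_cast; ring
  rw [amplitude, if_pos h1, one_mul, h5, Real.rpow_natCast, h4]
  push_cast; rfl

variable [Fact p.Prime]

theorem pow_ne_zero_of_prime (m : ℕ) : (p : ℂ) ^ m ≠ 0 :=
  pow_ne_zero _ (by exact_mod_cast (Fact.out : p.Prime).ne_zero)

theorem stdAddChar_ne_neg (hp : Odd p) (i j : ZMod p) :
    ZMod.stdAddChar i ≠ (-ZMod.stdAddChar j : ℂ) := by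
  intro h
  have h1 : ∀ k : ZMod p, (ZMod.stdAddChar k : ℂ) ^ p = 1 := by
    intro k
    rw [← AddChar.map_nsmul_eq_pow]; simp
  have h2 := congrArg (· ^ p) h
  simp only [hp.neg_pow, h1] at h2
  norm_num at h2

theorem norm_walsh_eq {f : (Fin n → ZMod p) → ZMod p} (hn : Even n) (hf : IsBent f)
    (α : Fin n → ZMod p) : ‖walsh f α‖ = (p : ℝ) ^ (n / 2) := by
  obtain ⟨m, rfl⟩ := hn
  rw [hf α, show (m + m) / 2 = m by omega, ← Real.rpow_natCast]
  congr 1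
  push_cast; ring

/-- The value `dual f α` is never the default one: a suitable exponent exists for bent `f`. -/
theorem walsh_eq_or (hp : Odd p) (hn : Even n) {f : (Fin n → ZMod p) → ZMod p} (hf : IsBent f)
    (α : Fin n → ZMod p) :
    walsh f α = (p : ℂ) ^ (n / 2) * ZMod.stdAddChar (dual f α) ∨
      walsh f α = -(p : ℂ) ^ (n / 2) * ZMod.stdAddChar (dual f α) := by
  have h : ∃ j : ZMod p, walsh f α = amplitude p n * ZMod.stdAddChar j ∨
      walsh f α = -amplitude p n * ZMod.stdAddChar j := by
    rw [amplitude_eq_pow hp hn]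
    exact exists_eq_pow_mul_stdAddChar_of_norm hp (fun x => f x - α ⬝ᵥ x) (n / 2)
      (norm_walsh_eq hn hf α)
  have h1 := h.choose_spec
  have h2 : dual f α = h.choose := by rw [dual, dif_pos h]
  rwa [← h2, amplitude_eq_pow hp hn] at h1

theorem mem_bMinus_iff (hp : Odd p) (hn : Even n) {f : (Fin n → ZMod p) → ZMod p}
    {α : Fin n → ZMod p} :
    α ∈ bMinus f ↔ walsh f α = -(p : ℂ) ^ (n / 2) * ZMod.stdAddChar (dual f α) := by
  rw [← amplitude_eq_pow hp hn]; rfl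

theorem mem_bPlus_iff (hp : Odd p) (hn : Even n) {f : (Fin n → ZMod p) → ZMod p}
    (hf : IsBent f) {α : Fin n → ZMod p} : α ∈ bPlus f ↔ α ∉ bMinus f := by
  rw [mem_bMinus_iff hp hn]
  have h0 : α ∈ bPlus f ↔ walsh f α = (p : ℂ) ^ (n / 2) * ZMod.stdAddChar (dual f α) := by
    rw [← amplitude_eq_pow hp hn]; rfl
  rw [h0]
  refine ⟨fun h h' => ?_, fun h => (walsh_eq_or hp hn hf α).resolve_right h⟩
  rw [h, neg_mul, ← mul_neg] at h'
  exact stdAddChar_ne_neg hp _ _ (mul_left_cancel₀ (pow_ne_zero_of_prime _) h')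

open Classical in
/-- The sign `ε` in `W_f(α) = ε p ^ (n / 2) ξ ^ f*(α)`, for bent `f` and even `n`. -/
noncomputable def walshSign (f : (Fin n → ZMod p) → ZMod p) (α : Fin n → ZMod p) : ℤ :=
  if α ∈ bMinus f then -1 else 1

theorem walsh_eq_sign_mul (hp : Odd p) (hn : Even n) {f : (Fin n → ZMod p) → ZMod p}
    (hf : IsBent f) (α : Fin n → ZMod p) :
    walsh f α = ((walshSign f α * p ^ (n / 2) : ℤ) : ℂ) * ZMod.stdAddChar (dual f α) := by
  by_cases h : α ∈ bMinus f
  · rw [(mem_bMinus_iff hp hn).1 h, walshSign, if_pos h]; push_cast; ring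
  · rw [(walsh_eq_or hp hn hf α).resolve_right (fun h' => h ((mem_bMinus_iff hp hn).2 h')),
      walshSign, if_neg h]
    push_cast; ring

/-- The sign and the dual are determined by the value of the Walsh transform. -/
theorem dual_eq_of_walsh_eq (hp : Odd p) (hn : Even n) {f : (Fin n → ZMod p) → ZMod p}
    (hf : IsBent f) {α β : Fin n → ZMod p} {j : ZMod p}
    (h : walsh f α = ((walshSign f β * p ^ (n / 2) : ℤ) : ℂ) * ZMod.stdAddChar j) :
    dual f α = j := by
  rw [walsh_eq_sign_mul hp hn hf] at h
  have hq := pow_ne_zero_of_prime (p := p) (n / 2)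
  have hi := (ZMod.injective_stdAddChar (N := p))
  unfold walshSign at h
  split_ifs at h <;> push_cast at h
  · apply hi; apply mul_left_cancel₀ hq; linear_combination -h
  · exact (stdAddChar_ne_neg hp (dual f α) j (mul_left_cancel₀ hq (by linear_combination -h))).elim
  · exact (stdAddChar_ne_neg hp (dual f α) j (mul_left_cancel₀ hq (by linear_combination h))).elim
  · apply hi; apply mul_left_cancel₀ hq; linear_combination h

open Classical in
/-- Orthogonality of characters on the subspace `V`. -/
theorem sum_mem_stdAddChar (V : Submodule (ZMod p) (Fin n → ZMod p)) (α : Fin n → ZMod p) :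
    ∑ y, (if y ∈ V then ZMod.stdAddChar (α ⬝ᵥ y) else 0) =
      if ∀ y ∈ V, α ⬝ᵥ y = 0 then (Nat.card V : ℂ) else 0 := by
  split_ifs with h
  · have : ∀ y, (if y ∈ V then ZMod.stdAddChar (α ⬝ᵥ y) else 0) = if y ∈ V then (1 : ℂ) else 0 := by
      intro y
      split_ifs with hy
      · rw [h y hy]; simp
      · rfl
    simp_rw [this]
    rw [Finset.sum_boole, Nat.card_eq_fintype_card, Fintype.card_subtype]
  · push Not at h
    obtain ⟨z, hz, hz0⟩ := h
    set S := ∑ y, (if y ∈ V then (ZMod.stdAddChar (α ⬝ᵥ y) : ℂ) else 0)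
    have h1 : ZMod.stdAddChar (α ⬝ᵥ z) * S = S := by
      rw [Finset.mul_sum]
      refine Fintype.sum_equiv (Equiv.addRight z) _ _ fun y => ?_
      simp only [Equiv.coe_addRight, V.add_mem_iff_left hz, mul_ite, mul_zero,
        dotProduct_add, AddChar.map_add_eq_mul]
      rw [mul_comm]
    have h2 : (ZMod.stdAddChar (α ⬝ᵥ z) : ℂ) ≠ 1 := by
      rw [← (ZMod.stdAddChar (N := p)).map_zero_eq_one]
      exact fun h => hz0 (ZMod.injective_stdAddChar h)
    have h3 : (ZMod.stdAddChar (α ⬝ᵥ z) - 1) * S = 0 := by linear_combination h1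
    exact (mul_eq_zero.1 h3).resolve_left (sub_ne_zero.2 h2)

theorem sum_stdAddChar_dotProduct (α : Fin n → ZMod p) :
    ∑ y, (ZMod.stdAddChar (α ⬝ᵥ y) : ℂ) = if α = 0 then (p : ℂ) ^ n else 0 := by
  have h := sum_mem_stdAddChar (p := p) (n := n) ⊤ α
  simp only [Submodule.mem_top, if_true, forall_const, dotProduct_eq_zero_iff] at h
  rw [h]
  split_ifs
  · simp
  · rfl

/-- Inversion of the Walsh transform. -/
theorem sum_walshSign_mul (hp : Odd p) (hn : Even n) {f : (Fin n → ZMod p) → ZMod p}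
    (hf : IsBent f) (y : Fin n → ZMod p) :
    ∑ α, (walshSign f α : ℂ) * ZMod.stdAddChar (dual f α + α ⬝ᵥ y) =
      (p : ℂ) ^ (n / 2) * ZMod.stdAddChar (f y) := by
  have hq := pow_ne_zero_of_prime (p := p) (n / 2)
  have h1 : ∑ α, walsh f α * ZMod.stdAddChar (α ⬝ᵥ y) = (p : ℂ) ^ n * ZMod.stdAddChar (f y) := by
    simp_rw [walsh, Finset.sum_mul]
    rw [Finset.sum_comm]
    have : ∀ x, ∑ α : Fin n → ZMod p, ZMod.stdAddChar (f x - α ⬝ᵥ x) * ZMod.stdAddChar (α ⬝ᵥ y) =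
        if x = y then (p : ℂ) ^ n * ZMod.stdAddChar (f y) else 0 := by
      intro x
      have h2 : ∀ α : Fin n → ZMod p,
          ZMod.stdAddChar (f x - α ⬝ᵥ x) * ZMod.stdAddChar (α ⬝ᵥ y) =
          (ZMod.stdAddChar (f x) * ZMod.stdAddChar ((y - x) ⬝ᵥ α) : ℂ) := by
        intro α
        rw [← AddChar.map_add_eq_mul, ← AddChar.map_add_eq_mul, sub_dotProduct,
          dotProduct_comm α x, dotProduct_comm α y]
        congr 1; ring
      simp_rw [h2]
      rw [← Finset.mul_sum, sum_stdAddChar_dotProduct]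
      by_cases hxy : x = y
      · simp [hxy, mul_comm]
      · rw [if_neg hxy, if_neg (sub_ne_zero.2 (Ne.symm hxy)), mul_zero]
    simp_rw [this]
    simp
  apply mul_left_cancel₀ hq
  have hsq : (p : ℂ) ^ (n / 2) * (p : ℂ) ^ (n / 2) = (p : ℂ) ^ n := by
    rw [← pow_add]; congr 1; obtain ⟨m, rfl⟩ := hn; omega
  rw [← mul_assoc, hsq, ← h1, Finset.mul_sum]
  refine Finset.sum_congr rfl fun α _ => ?_
  rw [walsh_eq_sign_mul hp hn hf, AddChar.map_add_eq_mul]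
  push_cast; ring

theorem sum_stdAddChar_dual (hp : Odd p) (hn : Even n) {f : (Fin n → ZMod p) → ZMod p}
    (hf' : IsBent (dual f)) (y : Fin n → ZMod p) :
    ∑ α, ZMod.stdAddChar (dual f α + α ⬝ᵥ y) =
      (walshSign (dual f) (-y) : ℂ) * (p : ℂ) ^ (n / 2) *
        ZMod.stdAddChar (dual (dual f) (-y)) := by
  have h := walsh_eq_sign_mul hp hn hf' (-y)
  push_cast at h
  rw [← h, walsh]
  refine Finset.sum_congr rfl fun α _ => ?_
  rw [neg_dotProduct, sub_neg_eq_add, dotProduct_comm]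

theorem exists_ne_and_ne (hp : Odd p) (a b : ZMod p) : ∃ c, c ≠ a ∧ c ≠ b := by
  obtain ⟨c, hc⟩ : ∃ c, c ∉ ({a, b} : Finset (ZMod p)) := by
    by_contra! hall
    have h1 : Fintype.card (ZMod p) ≤ ({a, b} : Finset (ZMod p)).card :=
      Finset.card_le_card fun x _ => hall x
    have h2 := Finset.card_le_two (a := a) (b := b)
    rw [ZMod.card] at h1
    have h3 := (Fact.out : p.Prime).two_le
    have : p = 2 := by omega
    rw [this] at hp
    exact absurd hp (by decide)
  exact ⟨c, by simpa using hc⟩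

/-- If integral multiples of two `p`-th roots of unity, the first one odd, add up to twice a cyclotomic
integer, then the two roots of unity agree: otherwise a third root of unity, which exists as `p ≥ 3`,
would have a coefficient of the wrong parity. -/
theorem eq_of_two_mul_sum_stdAddChar (hp : Odd p) {X : Type*} [Fintype X] {w : X → ℤ}
    {g : X → ZMod p} {k l : ℤ} (hk : Odd k) {a b : ZMod p}
    (h : 2 * ∑ x, (w x : ℂ) * ZMod.stdAddChar (g x) =
      k * ZMod.stdAddChar a + l * ZMod.stdAddChar b) : a = b := by
  by_contra hab
  set A : ZMod p → ℤ := fun i => 2 * (∑ x, if g x = i then w x else 0) -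
    (if i = a then k else 0) - if i = b then l else 0 with hA
  have h0 : ∑ i, (A i : ℂ) * ZMod.stdAddChar i = 0 := by
    simp only [hA]
    push_cast
    simp_rw [sub_mul, mul_assoc, Finset.sum_mul, ite_mul, zero_mul]
    rw [Finset.sum_sub_distrib, Finset.sum_sub_distrib, ← Finset.mul_sum, Finset.sum_comm]
    simp [h]
  obtain ⟨c, hca, hcb⟩ := exists_ne_and_ne hp a b
  have hac := eq_of_sum_mul_stdAddChar_eq_zero h0 a c
  simp only [hA, if_true, if_neg hab, if_neg hca, if_neg hcb] at hac
  obtain ⟨t, rfl⟩ := hk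
  omega

/-- The sum of `ξ ^ (f*(α) + α·y)` over the complement of `B₋(f)` is half of
`q ξ ^ f(y) ± q ξ ^ f**(-y)`, where `q` is odd, so the two exponents agree. -/
theorem dual_dual_neg (hp : Odd p) (hn : Even n) {f : (Fin n → ZMod p) → ZMod p}
    (hf : IsBent f) (hf' : IsBent (dual f)) (y : Fin n → ZMod p) :
    dual (dual f) (-y) = f y := by
  classical
  symm
  have h1 := sum_walshSign_mul hp hn hf y
  have h2 := sum_stdAddChar_dual hp hn hf' y
  refine eq_of_two_mul_sum_stdAddChar hp (X := Fin n → ZMod p)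
    (w := fun α => if α ∈ bMinus f then 0 else 1) (g := fun α => dual f α + α ⬝ᵥ y)
    (k := (p : ℤ) ^ (n / 2)) (l := walshSign (dual f) (-y) * p ^ (n / 2))
    (Odd.pow (by exact_mod_cast hp)) ?_
  push_cast
  rw [← h1, ← h2, Finset.mul_sum, ← Finset.sum_add_distrib]
  refine Finset.sum_congr rfl fun α _ => ?_
  unfold walshSign
  split_ifs <;> push_cast <;> ring

open Classical in
/-- The part of the inversion formula supported on `B₋(f)` is supported on `-B₋(f*)`. -/
theorem sum_bMinus (hp : Odd p) (hn : Even n) {f : (Fin n → ZMod p) → ZMod p}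
    (hf : IsBent f) (hf' : IsBent (dual f)) (y : Fin n → ZMod p) :
    ∑ α, (if α ∈ bMinus f then ZMod.stdAddChar (dual f α + α ⬝ᵥ y) else 0) =
      if -y ∈ bMinus (dual f) then -(p : ℂ) ^ (n / 2) * ZMod.stdAddChar (f y) else 0 := by
  have h1 := sum_walshSign_mul hp hn hf y
  have h2 := sum_stdAddChar_dual hp hn hf' y
  rw [dual_dual_neg hp hn hf hf'] at h2
  have h3 : 2 * ∑ α, (if α ∈ bMinus f then (ZMod.stdAddChar (dual f α + α ⬝ᵥ y) : ℂ) else 0) =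
      ∑ α, ZMod.stdAddChar (dual f α + α ⬝ᵥ y) -
        ∑ α, (walshSign f α : ℂ) * ZMod.stdAddChar (dual f α + α ⬝ᵥ y) := by
    rw [Finset.mul_sum, ← Finset.sum_sub_distrib]
    refine Finset.sum_congr rfl fun α _ => ?_
    unfold walshSign
    split_ifs <;> push_cast <;> ring
  rw [h1, h2] at h3
  unfold walshSign at h3
  split_ifs at h3 ⊢ <;> push_cast at h3 <;> linear_combination h3 / 2

/-- If `f` is homogeneous of degree `h` then `f*(a ^ (h - 1) α) = a ^ h f*(α)`, and every nonzero
scalar is of the form `a ^ (h - 1)`. -/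
theorem exists_homogeneous_dual (hp : Odd p) (hn : Even n) {f : (Fin n → ZMod p) → ZMod p}
    (hf : IsBent f) {h : ℕ} (hh : 0 < h) (hcop : Nat.gcd (h - 1) (p - 1) = 1)
    (hhom : ∀ (a : ZMod p) (x : Fin n → ZMod p), a ≠ 0 → f (a • x) = a ^ h * f x) :
    ∃ l : ℕ, ∀ (b : ZMod p) (α : Fin n → ZMod p), b ≠ 0 →
      dual f (b • α) = b ^ l * dual f α := by
  have hpp : p.Prime := Fact.out
  have hp3 : 1 < p - 1 := by
    have := hpp.two_le
    rcases hp with ⟨k, rfl⟩; omega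
  -- the Galois automorphism `ξ ↦ ξ ^ (a ^ h)` moves `W_f(α)` to `W_f(a ^ (h - 1) α)`
  have key : ∀ (a : ZMod p) (α : Fin n → ZMod p), a ≠ 0 →
      dual f (a ^ (h - 1) • α) = a ^ h * dual f α := by
    intro a α ha
    apply dual_eq_of_walsh_eq hp hn hf (β := α)
    have h1 : ∑ x, ((1 : ℤ) : ℂ) * ZMod.stdAddChar (f x - α ⬝ᵥ x) =
        ((walshSign f α * p ^ (n / 2) : ℤ) : ℂ) * ZMod.stdAddChar (dual f α) := by
      rw [← walsh_eq_sign_mul hp hn hf]; simp [walsh]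
    rw [← sum_mul_stdAddChar_mul (w := fun _ => (1 : ℤ)) (pow_ne_zero h ha) h1, walsh,
      ← (Equiv.smulRight ha).sum_comp]
    refine Finset.sum_congr rfl fun x _ => ?_
    simp only [Equiv.smulRight_apply, hhom a x ha, dotProduct_smul, smul_dotProduct, smul_eq_mul,
      Int.cast_one, one_mul]
    congr 1
    obtain ⟨k, rfl⟩ : ∃ k, h = k + 1 := ⟨h - 1, by omega⟩
    rw [Nat.add_sub_cancel]; ring
  obtain ⟨u, -, hu⟩ := Nat.exists_mul_mod_eq_one_of_coprime hcop hp3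
  refine ⟨u * h, fun b α hb => ?_⟩
  have h1 : (b ^ u) ^ (h - 1) = b := by
    rw [← pow_mul, mul_comm u, ← Nat.div_add_mod ((h - 1) * u) (p - 1), hu, pow_add, pow_mul,
      ZMod.pow_card_sub_one_eq_one hb]
    simp
  have h2 := key (b ^ u) α (pow_ne_zero _ hb)
  rwa [h1, ← pow_mul] at h2

theorem even_of_gcd_eq_one (hp : Odd p) {h : ℕ} (hh : 0 < h)
    (hcop : Nat.gcd (h - 1) (p - 1) = 1) : Even h := by
  by_contra hodd
  rw [Nat.not_even_iff_odd] at hodd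
  have h1 : 2 ∣ Nat.gcd (h - 1) (p - 1) := by
    apply Nat.dvd_gcd
    · obtain ⟨k, rfl⟩ := hodd; simp
    · obtain ⟨k, rfl⟩ := hp; simp
  rw [hcop] at h1
  omega

end

/-! ### Fourier transforms of functions constant on classes -/

section

variable {p n : ℕ} [Fact p.Prime]

/-- The orthogonal complement `V^⊥` as a submodule. -/
def perpSubmodule (V : Submodule (ZMod p) (Fin n → ZMod p)) :
    Submodule (ZMod p) (Fin n → ZMod p) where
  carrier := perp (V : Set (Fin n → ZMod p))
  zero_mem' := fun y _ => zero_dotProduct y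
  add_mem' := fun {a b} ha hb y hy => by rw [add_dotProduct, ha y hy, hb y hy, add_zero]
  smul_mem' := fun c a ha y hy => by rw [smul_dotProduct, ha y hy, smul_zero]

theorem mem_perpSubmodule {V : Submodule (ZMod p) (Fin n → ZMod p)} {x : Fin n → ZMod p} :
    x ∈ perpSubmodule V ↔ ∀ y ∈ V, x ⬝ᵥ y = 0 := Iff.rfl

theorem perpSubmodule_eq_orthogonal (V : Submodule (ZMod p) (Fin n → ZMod p)) :
    perpSubmodule V =
      LinearMap.BilinForm.orthogonal (dotProductBilin (m := Fin n) (ZMod p) (ZMod p)) V := by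
  ext x
  rw [mem_perpSubmodule, LinearMap.BilinForm.mem_orthogonal_iff]
  refine forall₂_congr fun y _ => ?_
  rw [dotProduct_comm]
  rfl

theorem dotProductBilin_isRefl :
    LinearMap.BilinForm.IsRefl (dotProductBilin (m := Fin n) (ZMod p) (ZMod p)) := by
  intro x y h
  exact (dotProduct_comm y x).trans h

theorem dotProductBilin_nondegenerate :
    LinearMap.BilinForm.Nondegenerate (dotProductBilin (m := Fin n) (ZMod p) (ZMod p)) := by
  refine ⟨fun x h => dotProduct_eq_zero x h, fun x h => dotProduct_eq_zero x fun y => ?_⟩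
  rw [dotProduct_comm]; exact h y

theorem finrank_perpSubmodule (V : Submodule (ZMod p) (Fin n → ZMod p)) :
    Module.finrank (ZMod p) (perpSubmodule V) = n - Module.finrank (ZMod p) V := by
  rw [perpSubmodule_eq_orthogonal,
    LinearMap.BilinForm.finrank_orthogonal dotProductBilin_nondegenerate, Module.finrank_fin_fun]

theorem perpSubmodule_perpSubmodule (V : Submodule (ZMod p) (Fin n → ZMod p)) :
    perpSubmodule (perpSubmodule V) = V := by
  rw [perpSubmodule_eq_orthogonal, perpSubmodule_eq_orthogonal,
    LinearMap.BilinForm.orthogonal_orthogonal dotProductBilin_nondegenerate dotProductBilin_isRefl]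

theorem card_submodule (V : Submodule (ZMod p) (Fin n → ZMod p)) :
    Nat.card V = p ^ Module.finrank (ZMod p) V := by
  rw [Module.natCard_eq_pow_finrank (K := ZMod p), Nat.card_zmod]

open Classical in
/-- The inversion formula of a bent function `g` with dual `f`, split along `W = B₋(g)`, in the case
where `W` and `V = B₋(f)` are subspaces: the exponential sum of `f` over `W` is supported on `V`, and
the one over the complement of `W` on the complement of `V`. Moreover `g` is homogeneous. -/
structure IsDualOn (f g : (Fin n → ZMod p) → ZMod p)
    (V W : Submodule (ZMod p) (Fin n → ZMod p)) : Prop where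
  sum_mem : ∀ α, ∑ y, (if y ∈ W then (ZMod.stdAddChar (f y + y ⬝ᵥ α) : ℂ) else 0) =
    if α ∈ V then -(p : ℂ) ^ (n / 2) * ZMod.stdAddChar (g α) else 0
  sum_notMem : ∀ α, ∑ y, (if y ∈ W then 0 else (ZMod.stdAddChar (f y + y ⬝ᵥ α) : ℂ)) =
    if α ∈ V then 0 else (p : ℂ) ^ (n / 2) * ZMod.stdAddChar (g α)
  homogeneous : ∃ l : ℕ, ∀ (b : ZMod p) α, b ≠ 0 → g (b • α) = b ^ l * g α

theorem isDualOn_dual (hp : Odd p) (hn : Even n) {f : (Fin n → ZMod p) → ZMod p}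
    (hf : IsBent f) (hf' : IsBent (dual f)) {V W : Submodule (ZMod p) (Fin n → ZMod p)}
    (hV : (V : Set (Fin n → ZMod p)) = bMinus f)
    (hW : (W : Set (Fin n → ZMod p)) = bMinus (dual f))
    (hhom : ∃ l : ℕ, ∀ (b : ZMod p) α, b ≠ 0 → f (b • α) = b ^ l * f α) :
    IsDualOn (dual f) f W V := by
  classical
  have hmemV : ∀ x, x ∈ bMinus f ↔ x ∈ V := fun x => by rw [← hV]; rfl
  have hmemW : ∀ x, x ∈ bMinus (dual f) ↔ x ∈ W := fun x => by rw [← hW]; rfl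
  have hmem : ∀ α, ∑ y, (if y ∈ V then (ZMod.stdAddChar (dual f y + y ⬝ᵥ α) : ℂ) else 0) =
      if α ∈ W then -(p : ℂ) ^ (n / 2) * ZMod.stdAddChar (f α) else 0 := by
    intro α
    have := sum_bMinus hp hn hf hf' α
    simpa only [hmemV, hmemW, neg_mem_iff] using this
  refine ⟨hmem, fun α => ?_, hhom⟩
  have h1 := sum_walshSign_mul hp hn hf α
  have h2 : ∑ y, (if y ∈ V then 0 else (ZMod.stdAddChar (dual f y + y ⬝ᵥ α) : ℂ)) =
      ∑ y, (walshSign f y : ℂ) * ZMod.stdAddChar (dual f y + y ⬝ᵥ α) +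
        ∑ y, (if y ∈ V then (ZMod.stdAddChar (dual f y + y ⬝ᵥ α) : ℂ) else 0) := by
    rw [← Finset.sum_add_distrib]
    refine Finset.sum_congr rfl fun y _ => ?_
    simp only [walshSign, hmemV]
    split_ifs <;> simp
  rw [h2, h1, hmem]
  split_ifs <;> ring

variable {f g : (Fin n → ZMod p) → ZMod p} {V W : Submodule (ZMod p) (Fin n → ZMod p)}

/-- The exponential sum of `f` over `W` takes the same value at `y ∈ W^⊥` as at the origin, where it
is not zero. -/
theorem IsDualOn.mem_and_eq_zero_of_mem_perp (h : IsDualOn f g V W) (hg0 : g 0 = 0)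
    {y : Fin n → ZMod p} (hy : y ∈ perpSubmodule W) : y ∈ V ∧ g y = 0 := by
  classical
  have h1 : ∀ z, (if z ∈ W then (ZMod.stdAddChar (f z + z ⬝ᵥ y) : ℂ) else 0) =
      if z ∈ W then (ZMod.stdAddChar (f z + z ⬝ᵥ 0) : ℂ) else 0 := by
    intro z
    split_ifs with hz
    · rw [dotProduct_comm z y, hy z hz, dotProduct_zero]
    · rfl
  have h2 := h.sum_mem y
  simp_rw [h1] at h2
  rw [h.sum_mem 0, if_pos V.zero_mem, hg0] at h2
  have hq := pow_ne_zero_of_prime (p := p) (n / 2)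
  split_ifs at h2 with hyV
  · refine ⟨hyV, (ZMod.injective_stdAddChar (mul_left_cancel₀ (neg_ne_zero.2 hq) h2)).symm⟩
  · simp [hq] at h2

/-- `x` and `y` lie in the same class: they agree in being zero, in lying in `W`, in lying in `V^⊥`,
and in the value of `f`. -/
def SameClass (f : (Fin n → ZMod p) → ZMod p) (V W : Submodule (ZMod p) (Fin n → ZMod p))
    (x y : Fin n → ZMod p) : Prop :=
  (x = 0 ↔ y = 0) ∧ (x ∈ W ↔ y ∈ W) ∧ (x ∈ perpSubmodule V ↔ y ∈ perpSubmodule V) ∧ f x = f y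

theorem SameClass.neg (hf : ∀ x, f (-x) = f x) {x y : Fin n → ZMod p} (h : SameClass f V W x y) :
    SameClass f V W (-x) (-y) := by
  simpa only [SameClass, neg_eq_zero, neg_mem_iff, hf] using h

theorem sameClass_neg (hf : ∀ x, f (-x) = f x) (x : Fin n → ZMod p) :
    SameClass f V W x (-x) := by
  simp only [SameClass, neg_eq_zero, neg_mem_iff, hf, and_self]

theorem SameClass.symm {x y : Fin n → ZMod p} (h : SameClass f V W x y) : SameClass f V W y x :=
  ⟨h.1.symm, h.2.1.symm, h.2.2.1.symm, h.2.2.2.symm⟩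

open Classical in
/-- For `c ≠ 0` the sum of `ξ ^ (c f(y) + y·α)` over `W` is the image under `ξ ↦ ξ ^ c` of the sum of
`ξ ^ (f(y) + y·(c⁻¹ α))`, which is known in terms of `g (c⁻¹ α)`; for `c = 0` it tells whether
`α ∈ W^⊥`. -/
theorem IsDualOn.sum_mem_mul_eq (h : IsDualOn f g V W) (c : ZMod p) {α β : Fin n → ZMod p}
    (hαβ : SameClass g W V α β) :
    ∑ y, (if y ∈ W then (ZMod.stdAddChar (c * f y + y ⬝ᵥ α) : ℂ) else 0) =
      ∑ y, (if y ∈ W then (ZMod.stdAddChar (c * f y + y ⬝ᵥ β) : ℂ) else 0) := by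
  obtain ⟨-, hV, hW, hg⟩ := hαβ
  by_cases hc : c = 0
  · simp only [hc, zero_mul, zero_add]
    simp_rw [dotProduct_comm _ α, dotProduct_comm _ β]
    rw [sum_mem_stdAddChar, sum_mem_stdAddChar]
    simp only [mem_perpSubmodule] at hW
    simp only [hW]
  obtain ⟨l, hl⟩ := h.homogeneous
  have key : ∀ γ, ∑ y, (if y ∈ W then (ZMod.stdAddChar (c * f y + y ⬝ᵥ γ) : ℂ) else 0) =
      ((if γ ∈ V then -(p : ℤ) ^ (n / 2) else 0 : ℤ) : ℂ) *
        ZMod.stdAddChar (c * ((c⁻¹) ^ l * g γ)) := by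
    intro γ
    have h1 : ∑ y, ((if y ∈ W then 1 else 0 : ℤ) : ℂ) *
        ZMod.stdAddChar (f y + y ⬝ᵥ (c⁻¹ • γ)) =
        ((if γ ∈ V then -(p : ℤ) ^ (n / 2) else 0 : ℤ) : ℂ) *
          ZMod.stdAddChar ((c⁻¹) ^ l * g γ) := by
      have h2 := h.sum_mem (c⁻¹ • γ)
      rw [V.smul_mem_iff (inv_ne_zero hc), hl _ _ (inv_ne_zero hc)] at h2
      push_cast
      simpa only [ite_mul, one_mul, zero_mul] using h2
    rw [← sum_mul_stdAddChar_mul hc h1]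
    refine Finset.sum_congr rfl fun y _ => ?_
    rw [mul_add, dotProduct_smul, smul_eq_mul, mul_inv_cancel_left₀ hc]
    push_cast
    simp only [ite_mul, one_mul, zero_mul]
  rw [key, key, hg]
  simp only [hV]

open Classical in
theorem IsDualOn.sum_notMem_mul_eq (h : IsDualOn f g V W) (c : ZMod p) {α β : Fin n → ZMod p}
    (hαβ : SameClass g W V α β) :
    ∑ y, (if y ∈ W then 0 else (ZMod.stdAddChar (c * f y + y ⬝ᵥ α) : ℂ)) =
      ∑ y, (if y ∈ W then 0 else (ZMod.stdAddChar (c * f y + y ⬝ᵥ β) : ℂ)) := by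
  obtain ⟨h0, hV, hW, hg⟩ := hαβ
  by_cases hc : c = 0
  · simp only [hc, zero_mul, zero_add]
    simp_rw [dotProduct_comm _ α, dotProduct_comm _ β]
    have h1 : ∀ γ : Fin n → ZMod p, ∑ y, (if y ∈ W then 0 else (ZMod.stdAddChar (γ ⬝ᵥ y) : ℂ)) =
        (if γ = 0 then (p : ℂ) ^ n else 0) -
          if γ ∈ perpSubmodule W then (Nat.card W : ℂ) else 0 := by
      intro γ
      simp only [mem_perpSubmodule]
      rw [← sum_stdAddChar_dotProduct, ← sum_mem_stdAddChar, ← Finset.sum_sub_distrib]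
      refine Finset.sum_congr rfl fun y _ => ?_
      split_ifs <;> simp
    rw [h1, h1]
    simp only [h0, hW]
  obtain ⟨l, hl⟩ := h.homogeneous
  have key : ∀ γ, ∑ y, (if y ∈ W then 0 else (ZMod.stdAddChar (c * f y + y ⬝ᵥ γ) : ℂ)) =
      ((if γ ∈ V then 0 else (p : ℤ) ^ (n / 2) : ℤ) : ℂ) *
        ZMod.stdAddChar (c * ((c⁻¹) ^ l * g γ)) := by
    intro γ
    have h1 : ∑ y, ((if y ∈ W then 0 else 1 : ℤ) : ℂ) *
        ZMod.stdAddChar (f y + y ⬝ᵥ (c⁻¹ • γ)) =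
        ((if γ ∈ V then 0 else (p : ℤ) ^ (n / 2) : ℤ) : ℂ) *
          ZMod.stdAddChar ((c⁻¹) ^ l * g γ) := by
      have h2 := h.sum_notMem (c⁻¹ • γ)
      rw [V.smul_mem_iff (inv_ne_zero hc), hl _ _ (inv_ne_zero hc)] at h2
      push_cast
      simpa only [ite_mul, one_mul, zero_mul] using h2
    rw [← sum_mul_stdAddChar_mul hc h1]
    refine Finset.sum_congr rfl fun y _ => ?_
    rw [mul_add, dotProduct_smul, smul_eq_mul, mul_inv_cancel_left₀ hc]
    push_cast
    simp only [ite_mul, one_mul, zero_mul]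
  rw [key, key, hg]
  simp only [hV]

/-- Fourier expansion of a function on `ZMod p`. -/
theorem exists_eq_sum_mul_stdAddChar (D : ZMod p → ℂ) :
    ∃ E : ZMod p → ℂ, ∀ j, D j = ∑ c, E c * ZMod.stdAddChar (c * j) := by
  refine ⟨fun c => (p : ℂ)⁻¹ * ZMod.dft D c, fun j => ?_⟩
  have h := congrFun (ZMod.dft.symm_apply_apply D) j
  rw [ZMod.invDFT_apply] at h
  rw [← h, smul_eq_mul, Finset.mul_sum]
  refine Finset.sum_congr rfl fun c _ => ?_
  rw [smul_eq_mul]; ring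

open Classical in
/-- A function constant on the classes is a combination of the indicator functions of `{0}` and `V^⊥`,
and of a function of `f` on `W` and another one on its complement. -/
theorem exists_decomposition {φ : (Fin n → ZMod p) → ℂ}
    (hφ : ∀ x y, SameClass f V W x y → φ x = φ y)
    (hperp : ∀ x ∈ perpSubmodule V, x ∈ W ∧ f x = 0) :
    ∃ (a b : ℂ) (C D : ZMod p → ℂ), ∀ y, φ y = (if y = 0 then a else 0) +
      (if y ∈ perpSubmodule V then b else 0) + (if y ∈ W then D (f y) else 0) +
      (if y ∈ W then 0 else C (f y)) := by
  -- `v P` is the value of `φ` on the set `P` if `P` lies in a single class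
  have hex : ∀ P : (Fin n → ZMod p) → Prop, ∃ v : ℂ,
      (∀ x y, P x → P y → SameClass f V W x y) → ∀ x, P x → φ x = v := by
    intro P
    by_cases h : ∃ x, P x
    · obtain ⟨x, hx⟩ := h
      exact ⟨φ x, fun hP y hy => hφ y x (hP y x hy hx)⟩
    · exact ⟨0, fun _ x hx => (h ⟨x, hx⟩).elim⟩
  choose v hv using hex
  have h00 : (0 : Fin n → ZMod p) ∈ perpSubmodule V := Submodule.zero_mem _
  set D : ZMod p → ℂ := fun j => v fun x => x ∈ W ∧ x ∉ perpSubmodule V ∧ f x = j with hD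
  set C : ZMod p → ℂ := fun j => v fun x => x ∉ W ∧ f x = j with hC
  set B : ℂ := v fun x => x ∈ perpSubmodule V ∧ x ≠ 0 with hB
  refine ⟨φ 0 - B, B - D 0, C, D, fun y => ?_⟩
  by_cases hy0 : y = 0
  · subst hy0
    simp [h00, (hperp 0 h00).2]
  by_cases hyp : y ∈ perpSubmodule V
  · obtain ⟨hyW, hyf⟩ := hperp y hyp
    simp only [hy0, hyp, hyW, hyf, if_true, if_false]
    rw [hB, hv (fun x => x ∈ perpSubmodule V ∧ x ≠ 0) _ y ⟨hyp, hy0⟩]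
    · ring
    · rintro x z ⟨hx, hx0⟩ ⟨hz, hz0⟩
      simp only [SameClass, hx, hz, hx0, hz0, (hperp x hx).1, (hperp z hz).1, (hperp x hx).2,
        (hperp z hz).2, and_self]
  by_cases hyW : y ∈ W
  · simp only [hy0, hyp, hyW, if_true, if_false, zero_add, add_zero]
    refine hv (fun x => x ∈ W ∧ x ∉ perpSubmodule V ∧ f x = f y) ?_ y ⟨hyW, hyp, rfl⟩
    rintro x z ⟨hx, hx1, hx2⟩ ⟨hz, hz1, hz2⟩
    have hx0 : x ≠ 0 := fun h => hx1 (h ▸ h00)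
    have hz0 : z ≠ 0 := fun h => hz1 (h ▸ h00)
    simp only [SameClass, hx, hz, hx0, hz0, hx1, hz1, hx2, hz2, and_self]
  · simp only [hy0, hyp, hyW, if_false, zero_add]
    refine hv (fun x => x ∉ W ∧ f x = f y) ?_ y ⟨hyW, rfl⟩
    rintro x z ⟨hx, hx2⟩ ⟨hz, hz2⟩
    have hx0 : x ≠ 0 := fun h => hx (h ▸ W.zero_mem)
    have hz0 : z ≠ 0 := fun h => hz (h ▸ W.zero_mem)
    have hx1 : x ∉ perpSubmodule V := fun h => hx (hperp x h).1
    have hz1 : z ∉ perpSubmodule V := fun h => hz (hperp z h).1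
    simp only [SameClass, hx, hz, hx0, hz0, hx1, hz1, hx2, hz2, and_self]

/-- The Fourier transform of a function constant on the classes of `f` is constant on the classes
of `g`. -/
theorem IsDualOn.fourier_eq (h : IsDualOn f g V W)
    (hperp : ∀ x ∈ perpSubmodule V, x ∈ W ∧ f x = 0) {φ : (Fin n → ZMod p) → ℂ}
    (hφ : ∀ x y, SameClass f V W x y → φ x = φ y) {α β : Fin n → ZMod p}
    (hαβ : SameClass g W V α β) :
    ∑ y, φ y * ZMod.stdAddChar (y ⬝ᵥ α) = ∑ y, φ y * ZMod.stdAddChar (y ⬝ᵥ β) := by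
  classical
  obtain ⟨a, b, C, D, hdec⟩ := exists_decomposition hφ hperp
  obtain ⟨C', hC'⟩ := exists_eq_sum_mul_stdAddChar C
  obtain ⟨D', hD'⟩ := exists_eq_sum_mul_stdAddChar D
  have key : ∀ γ, ∑ y, φ y * ZMod.stdAddChar (y ⬝ᵥ γ) =
      a + b * (if γ ∈ V then (Nat.card (perpSubmodule V) : ℂ) else 0) +
      ∑ c, D' c * ∑ y, (if y ∈ W then (ZMod.stdAddChar (c * f y + y ⬝ᵥ γ) : ℂ) else 0) +
      ∑ c, C' c * ∑ y, (if y ∈ W then 0 else (ZMod.stdAddChar (c * f y + y ⬝ᵥ γ) : ℂ)) := by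
    intro γ
    have h1 : a = ∑ y : Fin n → ZMod p, if y = 0 then a * ZMod.stdAddChar (y ⬝ᵥ γ) else 0 := by
      simp
    have h2 : (if γ ∈ V then (Nat.card (perpSubmodule V) : ℂ) else 0) =
        ∑ y, if y ∈ perpSubmodule V then ZMod.stdAddChar (y ⬝ᵥ γ) else 0 := by
      simp_rw [dotProduct_comm _ γ]
      rw [sum_mem_stdAddChar]
      simp only [← mem_perpSubmodule, perpSubmodule_perpSubmodule]
    have h3 : ∑ c, D' c * ∑ y, (if y ∈ W then (ZMod.stdAddChar (c * f y + y ⬝ᵥ γ) : ℂ) else 0) =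
        ∑ y, if y ∈ W then D (f y) * ZMod.stdAddChar (y ⬝ᵥ γ) else 0 := by
      simp_rw [Finset.mul_sum]
      rw [Finset.sum_comm]
      refine Finset.sum_congr rfl fun y _ => ?_
      split_ifs
      · rw [hD', Finset.sum_mul]
        simp_rw [AddChar.map_add_eq_mul, mul_assoc]
      · simp
    have h4 : ∑ c, C' c * ∑ y, (if y ∈ W then 0 else (ZMod.stdAddChar (c * f y + y ⬝ᵥ γ) : ℂ)) =
        ∑ y, if y ∈ W then 0 else C (f y) * ZMod.stdAddChar (y ⬝ᵥ γ) := by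
      simp_rw [Finset.mul_sum]
      rw [Finset.sum_comm]
      refine Finset.sum_congr rfl fun y _ => ?_
      split_ifs
      · simp
      · rw [hC', Finset.sum_mul]
        simp_rw [AddChar.map_add_eq_mul, mul_assoc]
    rw [h3, h4, h2, Finset.mul_sum]
    conv_rhs => rw [h1]
    rw [← Finset.sum_add_distrib, ← Finset.sum_add_distrib, ← Finset.sum_add_distrib]
    refine Finset.sum_congr rfl fun y _ => ?_
    rw [hdec]
    split_ifs <;> ring
  have hmem : (if α ∈ V then (Nat.card (perpSubmodule V) : ℂ) else 0) =
      if β ∈ V then (Nat.card (perpSubmodule V) : ℂ) else 0 := by simp only [hαβ.2.1]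
  rw [key, key, hmem]
  simp_rw [h.sum_mem_mul_eq _ hαβ, h.sum_notMem_mul_eq _ hαβ]

/-- Functions constant on the classes of `f` are closed under convolution: their Fourier transforms
are constant on the classes of `g`, hence so is the product of these, and a second Fourier transform
leads back to `f`. -/
theorem convolution_eq (h : IsDualOn f g V W) (h' : IsDualOn g f W V) (hf0 : f 0 = 0)
    (hg0 : g 0 = 0) (hf : ∀ x, f (-x) = f x) {φ ψ : (Fin n → ZMod p) → ℂ}
    (hφ : ∀ x y, SameClass f V W x y → φ x = φ y) (hψ : ∀ x y, SameClass f V W x y → ψ x = ψ y)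
    {s t : Fin n → ZMod p} (hst : SameClass f V W s t) :
    ∑ z, φ (s - z) * ψ z = ∑ z, φ (t - z) * ψ z := by
  have hperp : ∀ x ∈ perpSubmodule V, x ∈ W ∧ f x = 0 :=
    fun x hx => h'.mem_and_eq_zero_of_mem_perp hf0 hx
  have hperp' : ∀ x ∈ perpSubmodule W, x ∈ V ∧ g x = 0 :=
    fun x hx => h.mem_and_eq_zero_of_mem_perp hg0 hx
  have key : ∀ t : Fin n → ZMod p, ∑ α, ((∑ y, φ y * ZMod.stdAddChar (y ⬝ᵥ α)) *
      ∑ z, ψ z * ZMod.stdAddChar (z ⬝ᵥ α)) * ZMod.stdAddChar (α ⬝ᵥ (-t)) =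
      (p : ℂ) ^ n * ∑ z, φ (t - z) * ψ z := by
    intro t
    have hy : ∀ y : Fin n → ZMod p, ∑ α, ∑ z, φ y * ZMod.stdAddChar (y ⬝ᵥ α) *
        (ψ z * ZMod.stdAddChar (z ⬝ᵥ α)) * ZMod.stdAddChar (α ⬝ᵥ (-t)) =
        ∑ z, if y = t - z then (p : ℂ) ^ n * (φ y * ψ z) else 0 := by
      intro y
      rw [Finset.sum_comm]
      refine Finset.sum_congr rfl fun z _ => ?_
      have hα : ∀ α : Fin n → ZMod p, φ y * ZMod.stdAddChar (y ⬝ᵥ α) *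
          (ψ z * ZMod.stdAddChar (z ⬝ᵥ α)) * ZMod.stdAddChar (α ⬝ᵥ (-t)) =
          φ y * ψ z * ZMod.stdAddChar ((y - (t - z)) ⬝ᵥ α) := by
        intro α
        rw [show (y - (t - z)) ⬝ᵥ α = y ⬝ᵥ α + z ⬝ᵥ α + α ⬝ᵥ (-t) by
          rw [dotProduct_comm α, neg_dotProduct, sub_dotProduct, sub_dotProduct]; ring,
          AddChar.map_add_eq_mul, AddChar.map_add_eq_mul]
        ring
      simp_rw [hα]
      rw [← Finset.mul_sum, sum_stdAddChar_dotProduct]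
      simp only [sub_eq_zero]
      split_ifs <;> ring
    simp_rw [Finset.sum_mul_sum, Finset.sum_mul]
    rw [Finset.sum_comm]
    simp_rw [hy]
    rw [Finset.sum_comm, Finset.mul_sum]
    simp
  have hF := h'.fourier_eq hperp' (φ := fun α => (∑ y, φ y * ZMod.stdAddChar (y ⬝ᵥ α)) *
      ∑ z, ψ z * ZMod.stdAddChar (z ⬝ᵥ α))
    (fun α β hαβ => by
      rw [h.fourier_eq hperp hφ hαβ, h.fourier_eq hperp hψ hαβ]) (hst.neg hf)
  rw [key, key] at hF
  exact mul_left_cancel₀ (pow_ne_zero_of_prime n) hF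

end

/-! ### The association scheme, and the sizes of level sets -/

section

variable {p n : ℕ} [Fact p.Prime]
variable {f g : (Fin n → ZMod p) → ZMod p} {V W : Submodule (ZMod p) (Fin n → ZMod p)}

/-- A partition into the classes of `f` induces a symmetric association scheme: the intersection
numbers are the values of convolutions of indicator functions of classes. -/
theorem inducesSymmetricScheme_of_sameClass {d : ℕ} {U : Fin (d + 1) → Set (Fin n → ZMod p)}
    (hU : IsIndexedPartition U) (hU0 : U 0 = {0})
    (hcls : ∀ i x y, x ∈ U i → (y ∈ U i ↔ SameClass f V W x y))
    (h : IsDualOn f g V W) (h' : IsDualOn g f W V) (hf0 : f 0 = 0)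
    (hg0 : g 0 = 0) (hf : ∀ x, f (-x) = f x) : InducesSymmetricScheme d U := by
  classical
  have hneg : ∀ i x, -x ∈ U i ↔ x ∈ U i := by
    intro i x
    refine ⟨fun hx => ?_, fun hx => (hcls i x _ hx).2 (sameClass_neg hf x)⟩
    exact (hcls i _ x hx).2 (sameClass_neg hf x).symm
  have hsymm : ∀ j, {q : (Fin n → ZMod p) × (Fin n → ZMod p) |
      (q.2, q.1) ∈ {q : (Fin n → ZMod p) × (Fin n → ZMod p) | q.1 - q.2 ∈ U j}} =
      {q | q.1 - q.2 ∈ U j} := by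
    intro j
    ext q
    simp only [Set.mem_ofPred_eq]
    rw [← neg_sub, hneg]
  refine ⟨hU, hU0, ⟨⟨?_, ?_, fun j => ⟨j, hsymm j⟩, ?_⟩, hsymm⟩⟩
  · refine ⟨fun i => ?_, fun i j hij => ?_, fun q => hU.cover (q.1 - q.2)⟩
    · obtain ⟨x, hx⟩ := hU.nonempty i
      exact ⟨(x, 0), by simpa using hx⟩
    · rw [Set.disjoint_left]
      exact fun q hq hq' => Set.disjoint_left.1 (hU.disjoint i j hij) hq hq'
  · ext q
    simp [hU0, sub_eq_zero]
  · have hind : ∀ u, ∀ x y, SameClass f V W x y →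
        (if x ∈ U u then (1 : ℂ) else 0) = if y ∈ U u then 1 else 0 := by
      intro u x y hxy
      have : x ∈ U u ↔ y ∈ U u :=
        ⟨fun hx => (hcls u x y hx).2 hxy, fun hy => (hcls u y x hy).2 hxy.symm⟩
      simp only [this]
    -- the number of `z` with `(x, z) ∈ R u` and `(z, y) ∈ R v` is a convolution at `x - y`
    have hcount : ∀ u v x y, (Set.ncard {z : Fin n → ZMod p | x - z ∈ U u ∧ z - y ∈ U v} : ℂ) =
        ∑ z, (if x - y - z ∈ U u then (1 : ℂ) else 0) * if z ∈ U v then 1 else 0 := by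
      intro u v x y
      rw [← (Equiv.subRight y).sum_comp, Set.ncard_eq_toFinset_card', Set.toFinset_ofPred,
        ← Finset.sum_boole]
      refine Finset.sum_congr rfl fun z _ => ?_
      simp only [Equiv.subRight_apply, sub_sub_sub_cancel_right, ← ite_and, mul_ite, mul_one,
        mul_zero, and_comm]
    choose x0 hx0 using hU.nonempty
    refine ⟨fun u v w => Set.ncard {z : Fin n → ZMod p | x0 w - z ∈ U u ∧ z - 0 ∈ U v},
      fun u v w x y hxy => ?_⟩
    have hc := convolution_eq h h' hf0 hg0 hf (hind u) (hind v)
      ((hcls w _ _ hxy).1 (hx0 w))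
    have h1 := hcount u v x y
    have h2 := hcount u v (x0 w) 0
    rw [sub_zero] at h2
    rw [hc, ← h2] at h1
    exact_mod_cast h1

/-- A symmetric subset of `𝔽_p^n`, `p` odd, not containing the origin has an even number of
elements. -/
theorem even_card_of_neg_mem (hp : Odd p) (T : Finset (Fin n → ZMod p))
    (h0 : (0 : Fin n → ZMod p) ∉ T)
    (hT : ∀ x ∈ T, -x ∈ T) : Even T.card := by
  have h1 : ∑ _x ∈ T, (1 : ZMod 2) = 0 := by
    refine Finset.sum_involution (fun x _ => -x) (fun _ _ => by decide) ?_ hT (fun x _ => neg_neg x)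
    intro x hx _ hxx
    apply h0
    have h2 : (2 : ZMod p) ≠ 0 := by
      intro h
      have h3 : p ∣ 2 := (ZMod.natCast_eq_zero_iff 2 p).1 (by exact_mod_cast h)
      rcases (Nat.dvd_prime Nat.prime_two).1 h3 with h4 | h4
      · exact (Fact.out : p.Prime).one_lt.ne' h4
      · rw [h4] at hp; exact absurd hp (by decide)
    have h4 : (2 : ZMod p) • x = 0 := by
      rw [two_smul]; nth_rewrite 1 [← hxx]; simp
    rwa [(smul_eq_zero.1 h4).resolve_left h2] at hx
  rw [Finset.sum_const, nsmul_one, ZMod.natCast_eq_zero_iff] at h1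
  exact even_iff_two_dvd.2 h1

open Classical in
/-- The level sets of `f` in `W` all have the same size, up to `p ^ (n / 2)` for the level `g 0`. -/
theorem IsDualOn.exists_card_mem (h : IsDualOn f g V W) : ∃ N : ℤ, ∀ i,
    ((Finset.univ.filter fun y => y ∈ W ∧ f y = i).card : ℤ) =
      N - if i = g 0 then (p : ℤ) ^ (n / 2) else 0 := by
  have h1 : ∑ y, ((if y ∈ W then 1 else 0 : ℤ) : ℂ) * ZMod.stdAddChar (f y) =
      ((-(p : ℤ) ^ (n / 2) : ℤ) : ℂ) * ZMod.stdAddChar (g 0) := by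
    have h2 := h.sum_mem 0
    rw [if_pos V.zero_mem] at h2
    push_cast
    simpa only [ite_mul, one_mul, zero_mul, dotProduct_zero, add_zero] using h2
  obtain ⟨N, hN⟩ := exists_fiber_sum_eq h1
  refine ⟨N, fun i => ?_⟩
  have h3 := hN i
  simp only [← ite_and] at h3
  rw [Finset.sum_boole] at h3
  simp only [and_comm]
  rw [h3]
  split_ifs <;> ring

open Classical in
/-- The level sets of `f` outside `W` all have the same size. -/
theorem IsDualOn.card_notMem (h : IsDualOn f g V W) (i j : ZMod p) :
    (Finset.univ.filter fun y => y ∉ W ∧ f y = i).card =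
      (Finset.univ.filter fun y => y ∉ W ∧ f y = j).card := by
  have h1 : ∑ y, ((if y ∈ W then 0 else 1 : ℤ) : ℂ) * ZMod.stdAddChar (f y) =
      ((0 : ℤ) : ℂ) * ZMod.stdAddChar (0 : ZMod p) := by
    have h2 := h.sum_notMem 0
    rw [if_pos V.zero_mem] at h2
    push_cast
    simpa only [ite_mul, one_mul, zero_mul, dotProduct_zero, add_zero] using h2
  obtain ⟨N, hN⟩ := exists_fiber_sum_eq h1
  have h3 : ∀ i, ((Finset.univ.filter fun y => y ∉ W ∧ f y = i).card : ℤ) = N := by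
    intro i
    have h4 := hN i
    rw [ite_self, add_zero] at h4
    rw [← h4, ← Finset.sum_boole]
    refine Finset.sum_congr rfl fun y _ => ?_
    by_cases hy : y ∈ W <;> simp [hy]
  exact_mod_cast (h3 i).trans (h3 j).symm

/-- As `f` is even and vanishes at the origin, its level sets in `W` have even size except for the
one of level `0`; this singles out `g 0`. -/
theorem IsDualOn.map_zero_eq_zero (h : IsDualOn f g V W) (hp : Odd p) (hf0 : f 0 = 0)
    (hf : ∀ x, f (-x) = f x) : g 0 = 0 := by
  classical
  obtain ⟨N, hN⟩ := h.exists_card_mem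
  have heven : ∀ i, i ≠ 0 → Even (Finset.univ.filter fun y => y ∈ W ∧ f y = i).card := by
    intro i hi
    refine even_card_of_neg_mem hp _ ?_ fun x hx => ?_
    · simp [hf0, hi.symm]
    · simpa [hf] using hx
  have hodd : Odd (Finset.univ.filter fun y => y ∈ W ∧ f y = 0).card := by
    have h0 : (0 : Fin n → ZMod p) ∈ Finset.univ.filter fun y => y ∈ W ∧ f y = 0 := by simp [hf0]
    rw [← Finset.card_erase_add_one h0]
    refine Even.add_one (even_card_of_neg_mem hp _ (Finset.notMem_erase _ _) fun x hx => ?_)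
    simpa [hf] using hx
  by_contra hg
  obtain ⟨c, hc0, hcg⟩ := exists_ne_and_ne hp 0 (g 0)
  obtain ⟨a, ha⟩ := heven c hc0
  obtain ⟨b, hb⟩ := hodd
  have h1 := hN c
  have h2 := hN 0
  rw [if_neg hcg, ha] at h1
  rw [if_neg (Ne.symm hg), hb] at h2
  push_cast at h1 h2
  omega

open Classical in
/-- The number of zeros of `f` in `W`. -/
theorem IsDualOn.card_zeros (h : IsDualOn f g V W) (hg0 : g 0 = 0) :
    (p : ℤ) * (Finset.univ.filter fun y => y ∈ W ∧ f y = 0).card =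
      p ^ Module.finrank (ZMod p) W + p ^ (n / 2) - p * p ^ (n / 2) := by
  obtain ⟨N, hN⟩ := h.exists_card_mem
  have htot : (Nat.card W : ℤ) =
      ∑ i, ((Finset.univ.filter fun y => y ∈ W ∧ f y = i).card : ℤ) := by
    rw [Nat.card_eq_fintype_card, Fintype.card_subtype,
      Finset.card_eq_sum_card_fiberwise (f := f) (t := Finset.univ) (fun _ _ => Finset.mem_univ _)]
    push_cast
    simp only [Finset.filter_filter]
  simp_rw [hN] at htot
  rw [Finset.sum_sub_distrib, card_submodule, hg0] at htot
  simp only [Finset.sum_const, Finset.card_univ, ZMod.card, Finset.sum_ite_eq', Finset.mem_univ,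
    if_true, nsmul_eq_mul] at htot
  push_cast at htot
  rw [hN, hg0, if_pos rfl, htot]
  ring

theorem IsDualOn.exists_mem_eq (h : IsDualOn f g V W) (hf0 : f 0 = 0) (hg0 : g 0 = 0) (j : ZMod p) :
    ∃ y ∈ W, f y = j := by
  classical
  obtain ⟨N, hN⟩ := h.exists_card_mem
  have h0 : 0 < (Finset.univ.filter fun y => y ∈ W ∧ f y = 0).card :=
    Finset.card_pos.2 ⟨0, by simp [hf0]⟩
  have hj : 0 < (Finset.univ.filter fun y => y ∈ W ∧ f y = j).card := by
    have h1 := hN 0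
    have h2 := hN j
    rw [hg0, if_pos rfl] at h1
    rw [hg0] at h2
    have h3 : (0 : ℤ) ≤ (p : ℤ) ^ (n / 2) := by positivity
    split_ifs at h2 <;> omega
  obtain ⟨y, hy⟩ := Finset.card_pos.1 hj
  exact ⟨y, by simpa using hy⟩

theorem IsDualOn.exists_notMem_eq (h : IsDualOn f g V W) (hW : W ≠ ⊤) (j : ZMod p) :
    ∃ y, y ∉ W ∧ f y = j := by
  classical
  obtain ⟨x, -, hx⟩ := SetLike.exists_of_lt hW.lt_top
  have hj : 0 < (Finset.univ.filter fun y => y ∉ W ∧ f y = j).card := by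
    rw [h.card_notMem j (f x)]
    exact Finset.card_pos.2 ⟨x, by simpa using hx⟩
  obtain ⟨y, hy⟩ := Finset.card_pos.1 hj
  exact ⟨y, by simpa using hy⟩

open Classical in
theorem card_filter_mem (U : Submodule (ZMod p) (Fin n → ZMod p)) :
    (Finset.univ.filter fun y => y ∈ U).card = p ^ Module.finrank (ZMod p) U := by
  rw [← card_submodule, Nat.card_eq_fintype_card, Fintype.card_subtype]

/-- For `dim W = n / 2 + 1` the zeros of `f` in `W` are the elements of `V^⊥`: both sets have
`p ^ (n / 2 - 1)` elements. -/
theorem IsDualOn.mem_perp_of_eq_zero (h : IsDualOn f g V W) (h' : IsDualOn g f W V) (hn : Even n)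
    (hn0 : 0 < n) (hf0 : f 0 = 0) (hg0 : g 0 = 0)
    (hV : Module.finrank (ZMod p) V = n / 2 + 1) (hW : Module.finrank (ZMod p) W = n / 2 + 1)
    {x : Fin n → ZMod p} (hx : x ∈ W) (hfx : f x = 0) : x ∈ perpSubmodule V := by
  classical
  have hsub : (Finset.univ.filter fun y => y ∈ perpSubmodule V) ⊆
      Finset.univ.filter fun y => y ∈ W ∧ f y = 0 := by
    intro y hy
    simpa using h'.mem_and_eq_zero_of_mem_perp hf0 (by simpa using hy)
  have hp : 0 < p := (Fact.out : p.Prime).pos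
  have hcard := h.card_zeros hg0
  have heq : (Finset.univ.filter fun y => y ∈ perpSubmodule V) =
      Finset.univ.filter fun y => y ∈ W ∧ f y = 0 := by
    refine Finset.eq_of_subset_of_card_le hsub ?_
    rw [card_filter_mem, finrank_perpSubmodule, hV]
    obtain ⟨m, hm⟩ : ∃ m, n / 2 = m + 1 := ⟨n / 2 - 1, by obtain ⟨k, rfl⟩ := hn; omega⟩
    rw [show n - (n / 2 + 1) = m by obtain ⟨k, rfl⟩ := hn; omega]
    rw [hW, hm] at hcard
    have h1 : (p : ℤ) * (Finset.univ.filter fun y => y ∈ W ∧ f y = 0).card = p * p ^ m := by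
      rw [hcard]; ring
    have h2 := mul_left_cancel₀ (by exact_mod_cast hp.ne') h1
    exact_mod_cast h2.le
  have hmem : x ∈ Finset.univ.filter fun y => y ∈ W ∧ f y = 0 := by simp [hx, hfx]
  rw [← heq] at hmem
  simpa using hmem

/-- For `dim W > n / 2 + 1`, `f` has zeros in `W` outside `V^⊥`. -/
theorem IsDualOn.exists_zero_notMem_perp (h : IsDualOn f g V W) (hn : Even n) (hg0 : g 0 = 0)
    {r : ℕ} (hV : Module.finrank (ZMod p) V = r) (hW : Module.finrank (ZMod p) W = r)
    (hr : n / 2 + 1 < r) : ∃ x ∈ W, f x = 0 ∧ x ∉ perpSubmodule V := by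
  classical
  by_contra! hall
  have hp : 1 < p := (Fact.out : p.Prime).one_lt
  have hle : (Finset.univ.filter fun y => y ∈ W ∧ f y = 0).card ≤
      (Finset.univ.filter fun y => y ∈ perpSubmodule V).card := by
    refine Finset.card_le_card fun y hy => ?_
    simp only [Finset.mem_filter, Finset.mem_univ, true_and] at hy ⊢
    exact hall y hy.1 hy.2
  rw [card_filter_mem, finrank_perpSubmodule, hV] at hle
  have hcard := h.card_zeros hg0
  rw [hW] at hcard
  have h1 : p * p ^ (n - r) ≤ p ^ (n / 2) := by
    rw [← pow_succ']
    rcases le_or_gt r n with hrn | hrn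
    · exact Nat.pow_le_pow_right hp.le (by obtain ⟨k, rfl⟩ := hn; omega)
    · rw [Nat.sub_eq_zero_of_le hrn.le]
      exact Nat.pow_le_pow_right hp.le (by
        have := Submodule.finrank_le W
        rw [Module.finrank_fin_fun, hW] at this
        omega)
  have h2 : p * p ^ (n / 2) < p ^ r := by
    rw [← pow_succ']
    exact Nat.pow_lt_pow_right hp hr
  have h3 : (p : ℤ) * (Finset.univ.filter fun y => y ∈ W ∧ f y = 0).card ≤ p * p ^ (n - r) := by
    exact_mod_cast Nat.mul_le_mul_left p hle
  have h4 : (p : ℤ) * p ^ (n - r) ≤ p ^ (n / 2) := by exact_mod_cast h1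
  have h5 : (p : ℤ) * p ^ (n / 2) < p ^ r := by exact_mod_cast h2
  omega

end

/-! ### The two families of classes -/

section

variable {p n : ℕ} [Fact p.Prime]
variable {f g : (Fin n → ZMod p) → ZMod p} {V W : Submodule (ZMod p) (Fin n → ZMod p)}

open Classical in
/-- The index of the class of `x`: `0` for the origin, `f x + 1` outside `W`, `p + 1` on
`V^⊥ \ {0}`, and `p + k + f x` on the rest of `W`. Here `k` is the index offset of `d_0`: it is `1` if
`d_0 \ {0} = V^⊥ \ {0}`, and `2` if `V^⊥ \ {0}` is a class of its own. -/
noncomputable def classLabel (k : ℕ) (f : (Fin n → ZMod p) → ZMod p)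
    (V W : Submodule (ZMod p) (Fin n → ZMod p)) (x : Fin n → ZMod p) : ℕ :=
  if x = 0 then 0 else if x ∉ W then (f x).val + 1 else if x ∈ perpSubmodule V then p + 1
  else p + k + (f x).val

theorem classLabel_eq_iff {k : ℕ} (hk : k = 2 ∨ k = 1 ∧ ∀ x ∈ W, f x = 0 → x ∈ perpSubmodule V)
    (hperp : ∀ x ∈ perpSubmodule V, x ∈ W ∧ f x = 0) (x y : Fin n → ZMod p) :
    classLabel k f V W x = classLabel k f V W y ↔ SameClass f V W x y := by
  have h00 : (0 : Fin n → ZMod p) ∈ perpSubmodule V := Submodule.zero_mem _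
  have hlt : ∀ z, (f z).val < p := fun z => ZMod.val_lt _
  have hinj : ∀ z w, (f z).val = (f w).val ↔ f z = f w :=
    fun z w => (ZMod.val_injective p).eq_iff
  have hpos : ∀ z ∈ W, z ∉ perpSubmodule V → 2 ≤ k + (f z).val := by
    intro z hz hz'
    rcases hk with rfl | ⟨rfl, hk⟩
    · omega
    · have : (f z).val ≠ 0 := fun h => hz' (hk z hz ((ZMod.val_eq_zero _).1 h))
      omega
  have hk1 : 1 ≤ k := by rcases hk with rfl | ⟨rfl, -⟩ <;> decide
  have hx := hlt x
  have hy := hlt y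
  have hxy := hinj x y
  have hpx := hpos x
  have hpy := hpos y
  unfold classLabel SameClass
  by_cases hx0 : x = 0
  · subst hx0
    by_cases hy0 : y = 0
    · subst hy0; simp
    · simp only [hy0, if_true, if_false, iff_false, not_true_eq_false, false_and]
      split_ifs <;> grind
  by_cases hy0 : y = 0
  · simp only [hx0, hy0, if_true, if_false, false_iff, not_true_eq_false, false_and, iff_false]
    split_ifs <;> grind
  have hpx0 := hperp x
  have hpy0 := hperp y
  by_cases hxW : x ∈ W <;> by_cases hyW : y ∈ W <;> by_cases hxV : x ∈ perpSubmodule V <;>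
    by_cases hyV : y ∈ perpSubmodule V <;>
    simp only [hx0, hy0, hxW, hyW, hxV, hyV, not_true_eq_false, not_false_eq_true, if_true,
      if_false, true_and, false_and, and_false, iff_true, iff_false, ← hxy, true_implies,
      false_implies, implies_true] at * <;> grind

/-- A family of sets which collects the elements by their label induces a symmetric scheme. -/
theorem inducesSymmetricScheme_of_classLabel {d k : ℕ} {U : Fin (d + 1) → Set (Fin n → ZMod p)}
    (hk : k = 2 ∨ k = 1 ∧ ∀ x ∈ W, f x = 0 → x ∈ perpSubmodule V) (hd : d = 2 * p + k - 1)
    (hU : ∀ i x, x ∈ U i ↔ classLabel k f V W x = i.val) (hne : ∀ i, (U i).Nonempty)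
    (h : IsDualOn f g V W) (h' : IsDualOn g f W V) (hf0 : f 0 = 0)
    (hg0 : g 0 = 0) (hf : ∀ x, f (-x) = f x) : InducesSymmetricScheme d U := by
  have hperp : ∀ x ∈ perpSubmodule V, x ∈ W ∧ f x = 0 :=
    fun x hx => h'.mem_and_eq_zero_of_mem_perp hf0 hx
  refine inducesSymmetricScheme_of_sameClass ⟨hne, fun i j hij => ?_, fun x => ?_⟩ ?_ ?_
    h h' hf0 hg0 hf
  · rw [Set.disjoint_left]
    exact fun x hx hx' => hij (Fin.ext (((hU i x).1 hx).symm.trans ((hU j x).1 hx')))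
  · have hlt : classLabel k f V W x < d + 1 := by
      have := ZMod.val_lt (f x)
      unfold classLabel
      split_ifs <;> omega
    exact ⟨⟨_, hlt⟩, (hU _ x).2 rfl⟩
  · ext x
    rw [hU, Set.mem_singleton_iff, Fin.val_zero]
    constructor
    · intro hx
      unfold classLabel at hx
      split_ifs at hx with h1 h2 h3
      · exact h1
      · rcases hk with rfl | ⟨rfl, -⟩ <;> omega
    · rintro rfl; simp [classLabel]
  · intro i x y hx
    rw [hU] at hx ⊢
    rw [← classLabel_eq_iff hk hperp, hx]
    exact eq_comm

theorem eq_natCast_iff {a : ZMod p} {k : ℕ} (hk : k < p) : a = (k : ZMod p) ↔ a.val = k := by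
  constructor
  · rintro rfl; exact ZMod.val_cast_of_lt hk
  · rintro rfl; simp

theorem mem_familyTwo_iff (hplus : ∀ x, x ∈ bPlus (dual f) ↔ x ∉ W)
    (hminus : ∀ x, x ∈ bMinus (dual f) ↔ x ∈ W)
    (hperp : ∀ x ∈ perpSubmodule V, x ∈ W ∧ f x = 0)
    (hzero : ∀ x ∈ W, f x = 0 → x ∈ perpSubmodule V) (i : Fin (2 * p + 1)) (x : Fin n → ZMod p) :
    x ∈ familyTwo f i ↔ classLabel 1 f V W x = i.val := by
  have hv := ZMod.val_lt (f x)
  have hi := i.isLt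
  have hx00 : x = 0 → x ∈ perpSubmodule V := fun h => h ▸ Submodule.zero_mem _
  have hpx := hperp x
  have hzx := hzero x
  have hval : (f x).val = 0 ↔ f x = 0 := ZMod.val_eq_zero _
  unfold familyTwo
  split_ifs with h1 h2 h3
  all_goals simp only [Set.mem_singleton_iff, cSet, dSet, Set.mem_ofPred_eq, Set.mem_sdiff, hplus,
    hminus]
  · rw [classLabel]; grind
  · rw [eq_natCast_iff (by omega), classLabel]; grind
  · rw [classLabel]; grind
  · rw [eq_natCast_iff (by omega), classLabel]; grind

theorem mem_familyThree_iff (hplus : ∀ x, x ∈ bPlus (dual f) ↔ x ∉ W)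
    (hminus : ∀ x, x ∈ bMinus (dual f) ↔ x ∈ W)
    (hperpf : ∀ x, x ∈ perp (bMinus f) ↔ x ∈ perpSubmodule V)
    (hperp : ∀ x ∈ perpSubmodule V, x ∈ W ∧ f x = 0)
    (i : Fin (2 * p + 1 + 1)) (x : Fin n → ZMod p) :
    x ∈ familyThree f i ↔ classLabel 2 f V W x = i.val := by
  have hv := ZMod.val_lt (f x)
  have hi := i.isLt
  have hx00 : x = 0 → x ∈ perpSubmodule V := fun h => h ▸ Submodule.zero_mem _
  have hpx := hperp x
  have hval : (f x).val = 0 ↔ f x = 0 := ZMod.val_eq_zero _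
  unfold familyThree
  split_ifs with h1 h2 h3 h4
  all_goals simp only [Set.mem_singleton_iff, cSet, dSet, Set.mem_ofPred_eq, Set.mem_sdiff, hplus,
    hminus, hperpf]
  · rw [classLabel]; grind
  · rw [eq_natCast_iff (by omega), classLabel]; grind
  · rw [classLabel]; grind
  · rw [classLabel]; grind
  · rw [eq_natCast_iff (by omega), classLabel]; grind

theorem nonempty_familyTwo (hplus : ∀ x, x ∈ bPlus (dual f) ↔ x ∉ W)
    (hminus : ∀ x, x ∈ bMinus (dual f) ↔ x ∈ W)
    (hc : ∀ j, ∃ x, x ∉ W ∧ f x = j) (hd : ∀ j, ∃ x ∈ W, f x = j)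
    (hd0 : ∃ x ∈ W, f x = 0 ∧ x ≠ 0) (i : Fin (2 * p + 1)) : (familyTwo f i).Nonempty := by
  unfold familyTwo
  split_ifs with h1 h2 h3
  · exact Set.singleton_nonempty _
  · obtain ⟨x, hx, hfx⟩ := hc ((i.val - 1 : ℕ) : ZMod p)
    exact ⟨x, (hplus x).2 hx, hfx⟩
  · obtain ⟨x, hx, hfx, hx0⟩ := hd0
    exact ⟨x, ⟨(hminus x).2 hx, hfx⟩, hx0⟩
  · obtain ⟨x, hx, hfx⟩ := hd ((i.val - (p + 1) : ℕ) : ZMod p)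
    exact ⟨x, (hminus x).2 hx, hfx⟩

theorem nonempty_familyThree (hplus : ∀ x, x ∈ bPlus (dual f) ↔ x ∉ W)
    (hminus : ∀ x, x ∈ bMinus (dual f) ↔ x ∈ W)
    (hperpf : ∀ x, x ∈ perp (bMinus f) ↔ x ∈ perpSubmodule V)
    (hc : ∀ j, ∃ x, x ∉ W ∧ f x = j) (hd : ∀ j, ∃ x ∈ W, f x = j)
    (hV : ∃ x ∈ perpSubmodule V, x ≠ 0) (hd0 : ∃ x ∈ W, f x = 0 ∧ x ∉ perpSubmodule V)
    (i : Fin (2 * p + 1 + 1)) : (familyThree f i).Nonempty := by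
  unfold familyThree
  split_ifs with h1 h2 h3 h4
  · exact Set.singleton_nonempty _
  · obtain ⟨x, hx, hfx⟩ := hc ((i.val - 1 : ℕ) : ZMod p)
    exact ⟨x, (hplus x).2 hx, hfx⟩
  · obtain ⟨x, hx, hx0⟩ := hV
    exact ⟨x, (hperpf x).2 hx, hx0⟩
  · obtain ⟨x, hx, hfx, hx0⟩ := hd0
    exact ⟨x, ⟨(hminus x).2 hx, hfx⟩, fun h => hx0 ((hperpf x).1 h)⟩
  · obtain ⟨x, hx, hfx⟩ := hd ((i.val - (p + 2) : ℕ) : ZMod p)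
    exact ⟨x, (hminus x).2 hx, hfx⟩

end

end BentScheme

theorem theorem2 (p : ℕ) [Fact p.Prime] (hp : Odd p) (n : ℕ) (hn : 4 ≤ n) (hn_even : Even n)
    (f : (Fin n → ZMod p) → ZMod p)
    (hf : BentScheme.IsNonWeaklyRegularBent f) (hf_dbf : BentScheme.IsDBF f)
    (r : ℕ) (hB : BentScheme.IsNondegenerateSubspace (BentScheme.bMinus f) r)
    (hB_dual : BentScheme.IsNondegenerateSubspace
      (BentScheme.bMinus (BentScheme.dual f)) r) :
    (r = n / 2 + 1 →
      BentScheme.InducesSymmetricScheme (2 * p) (BentScheme.familyTwo f)) ∧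
    (n / 2 + 1 < r → r ≤ n - 1 →
      BentScheme.InducesSymmetricScheme (2 * p + 1) (BentScheme.familyThree f)) := by
  open BentScheme in
  obtain ⟨V, hV, hVr, -⟩ := hB
  obtain ⟨W, hW, hWr, -⟩ := hB_dual
  obtain ⟨k, hk, hcop, hhom⟩ := hf_dbf.homogeneous
  have hbent := hf_dbf.bent
  have hdual := hf_dbf.dual_bent
  have hf0 := hf_dbf.map_zero
  have heven : ∀ x, f (-x) = f x := by
    intro x
    have h1 := hhom (-1) x (neg_ne_zero.2 one_ne_zero)
    rwa [(even_of_gcd_eq_one hp hk hcop).neg_one_pow, one_mul, neg_one_smul] at h1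
  have hdd : dual (dual f) = f := by
    funext x
    have h1 := dual_dual_neg hp hn_even hbent hdual (-x)
    rwa [neg_neg, heven] at h1
  have h' : IsDualOn (dual f) f W V :=
    isDualOn_dual hp hn_even hbent hdual hV hW ⟨k, fun b α hb => hhom b α hb⟩
  have h : IsDualOn f (dual f) V W := by
    have h1 := isDualOn_dual (f := dual f) (V := W) (W := V) hp hn_even hdual (by rwa [hdd]) hW
      (by rw [hdd, hV]) (exists_homogeneous_dual hp hn_even hbent hk hcop hhom)
    rwa [hdd] at h1
  have hg0 : dual f 0 = 0 := h.map_zero_eq_zero hp hf0 heven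
  have hminus : ∀ x, x ∈ bMinus (dual f) ↔ x ∈ W := fun x => by rw [← hW]; rfl
  have hplus : ∀ x, x ∈ bPlus (dual f) ↔ x ∉ W := fun x => by
    rw [mem_bPlus_iff hp hn_even hdual, hminus]
  have hperpf : ∀ x, x ∈ perp (bMinus f) ↔ x ∈ perpSubmodule V := fun x => by rw [← hV]; rfl
  have hperp : ∀ x ∈ perpSubmodule V, x ∈ W ∧ f x = 0 :=
    fun x hx => h'.mem_and_eq_zero_of_mem_perp hf0 hx
  have hd : ∀ j, ∃ x ∈ W, f x = j := h.exists_mem_eq hf0 hg0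
  have hc : r < n → ∀ j, ∃ x, x ∉ W ∧ f x = j := by
    intro hr
    refine h.exists_notMem_eq fun htop => ?_
    rw [htop, finrank_top, Module.finrank_fin_fun] at hWr
    omega
  have hVne : r < n → ∃ x ∈ perpSubmodule V, x ≠ 0 := by
    intro hr
    refine (perpSubmodule V).exists_mem_ne_zero_of_ne_bot fun hbot => ?_
    have h1 := finrank_perpSubmodule V
    rw [hbot, finrank_bot, hVr] at h1
    omega
  have hn2 : n / 2 + 1 < n := by obtain ⟨m, rfl⟩ := hn_even; omega
  constructor
  · intro hr
    have hzero : ∀ x ∈ W, f x = 0 → x ∈ perpSubmodule V := fun x hx hfx =>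
      h.mem_perp_of_eq_zero h' hn_even (by omega) hf0 hg0 (hVr.trans hr) (hWr.trans hr) hx hfx
    refine inducesSymmetricScheme_of_classLabel (Or.inr ⟨rfl, hzero⟩) (by omega)
      (mem_familyTwo_iff hplus hminus hperp hzero)
      (nonempty_familyTwo hplus hminus (hc (by omega)) hd ?_) h h' hf0 hg0 heven
    obtain ⟨x, hx, hx0⟩ := hVne (by omega)
    exact ⟨x, (hperp x hx).1, (hperp x hx).2, hx0⟩
  · intro hr hrn
    exact inducesSymmetricScheme_of_classLabel (Or.inl rfl) (by omega)
      (mem_familyThree_iff hplus hminus hperpf hperp)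
      (nonempty_familyThree hplus hminus hperpf (hc (by omega)) hd (hVne (by omega))
        (h.exists_zero_notMem_perp hn_even hg0 hVr hWr hr)) h h' hf0 hg0 heven
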